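/- Conventions. A complete local ring is a Noetherian local ring $(R,\mathfrak m)$ that is complete and separated in its $\mathfrak m$-adic topology. Let $E_R$ be the injective hull of the residue field $R/\mathfrak m$. For an arbitrary (not necessarily finitely generated) $R$-module $\Omega$, its Matlis dual is $\operatorname{Hom}_R(\Omega,E_R)$, and, for an integer $i$, its $i$-th higher canonical module $K^i_R(\Omega)$ is the Matlis dual of the local cohomology module $H^{\dim R-i}_{\mathfrak m}(\Omega)$, where local cohomology in negative degrees is $0$. Let $R$ be a complete local ring with maximal ideal $\mathfrak m$. (A) Let $\varphi\colon (S,\mathfrak n)\to(R,\mathfrak m)$ be a finite morphism of complete local rings, of relative dimension $r:=\dim S-\dim R$, let $\Omega$ be an $R$-module, and let $\varphi_*\Omega$ be its pull-back along $\varphi$, that is, $\Omega$ viewed as an $S$-module. Then: 1. $\operatorname{Hom}_R(\Omega,E_R)\cong\operatorname{Hom}_S(\varphi_*\Omega,E_S)$ as $S$-modules, and $H^i_{\mathfrak m}(\Omega)\cong H^i_{\mathfrak n}(\varphi_*\Omega)$ as $S$-modules, for all $i\ge 0$. 2. $K^i_R(\Omega)\cong K^{r+i}_S(\varphi_*\Omega)$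 as $S$-modules, for all $i$. (B) There exist a complete local ring $S$ that is Gorenstein (of finite injective dimension as a module over itself), and hence Cohen–Macaulay, and a finite morphism $\varphi\colon S\to R$ with $\dim S=\dim R$; and hence, for this $\varphi$, there are isomorphisms of $S$-modules $K^i_R(\Omega)\cong K^i_S(\varphi_*\Omega)$ for all $R$-modules $\Omega$ and all $i$. -/

import Mathlib

open CategoryTheory

universe u

/-! ### Injective hulls -/

/-- `f : M → E` exhibits `E` as an injective hull of `M`: the module `E` is injective, `f` is
injective, and `E` is an essential extension of the image of `f`. -/
structure IsInjectiveHull {R : Type u} [CommRing R] {M E : Type u} [AddCommGroup M] [Module R M]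
    [AddCommGroup E] [Module R E] (f : M →ₗ[R] E) : Prop where
  injective_module : Module.Injective R E
  injective_map : Function.Injective f
  essential : ∀ K : Submodule R E, K ⊓ LinearMap.range f = ⊥ → K = ⊥

/-- Every module embeds into an injective module. -/
theorem exists_injective_embedding (R : Type u) [CommRing R] (M : Type u) [AddCommGroup M]
    [Module R M] : ∃ (I : Type u) (_ : AddCommGroup I) (_ : Module R I) (f : M →ₗ[R] I),
      Module.Injective R I ∧ Function.Injective f := by
  let J : ModuleCat.{u} R := Injective.under (ModuleCat.of R M)
  refine ⟨J, inferInstance, inferInstance, (Injective.ι (ModuleCat.of R M)).hom, ?_, ?_⟩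
  · have : Injective (ModuleCat.of R J) := inferInstanceAs (Injective (Injective.under _))
    exact Module.injective_module_of_injective_object R J
  · exact (ModuleCat.mono_iff_injective _).1 inferInstance

/-- Every module has an injective hull. -/
theorem exists_isInjectiveHull (R : Type u) [CommRing R] (M : Type u) [AddCommGroup M]
    [Module R M] : ∃ (E : Type u) (_ : AddCommGroup E) (_ : Module R E) (f : M →ₗ[R] E),
      IsInjectiveHull f := by
  obtain ⟨I, _, _, f, hI, hf⟩ := exists_injective_embedding R M
  -- a maximal essential extension `E` of `M` inside `I`
  obtain ⟨E, hME, hE⟩ := zorn_le_nonempty₀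
    {N : Submodule R I | ∀ K ≤ N, K ⊓ LinearMap.range f = ⊥ → K = ⊥} (by
      intro c hc hchain N₀ hN₀
      refine ⟨sSup c, ?_, fun z hz => le_sSup hz⟩
      intro K hK hKM
      rw [eq_bot_iff]
      intro x hx
      obtain ⟨N, hN, hxN⟩ :=
        (Submodule.mem_sSup_of_directed ⟨N₀, hN₀⟩ hchain.directedOn).1 (hK hx)
      have hx' : Submodule.span R {x} ≤ K := by
        simpa [Submodule.span_le] using hx
      have := hc hN (Submodule.span R {x}) (by simpa [Submodule.span_le] using hxN)
        (eq_bot_iff.2 ((inf_le_inf_right _ hx').trans hKM.le))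
      simpa using this)
    (LinearMap.range f) (fun K hK h => by rwa [inf_eq_left.2 hK] at h)
  have hEess := hE.prop
  -- a maximal submodule `C` of `I` meeting `E` trivially
  obtain ⟨C, -, hC⟩ := zorn_le_nonempty₀ {N : Submodule R I | N ⊓ E = ⊥} (by
      intro c hc hchain N₀ hN₀
      refine ⟨sSup c, ?_, fun z hz => le_sSup hz⟩
      rw [Set.mem_ofPred_eq, eq_bot_iff]
      rintro x ⟨hx, hxE⟩
      obtain ⟨N, hN, hxN⟩ := (Submodule.mem_sSup_of_directed ⟨N₀, hN₀⟩ hchain.directedOn).1 hx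
      have : x ∈ N ⊓ E := ⟨hxN, hxE⟩
      rwa [hc hN] at this) ⊥ (by simp)
  have hCE : C ⊓ E = ⊥ := hC.prop
  -- the inclusion of `E` extends along `E → I / C`
  obtain ⟨g, hg⟩ := hI.out (C.mkQ ∘ₗ E.subtype) (by
      rw [← LinearMap.ker_eq_bot, eq_bot_iff]
      rintro ⟨x, hxE⟩ hx
      have hxC : x ∈ C := by simpa using hx
      have : x ∈ C ⊓ E := ⟨hxC, hxE⟩
      rw [hCE] at this
      simpa using this) E.subtype
  set h : I →ₗ[R] I := g ∘ₗ C.mkQ with hh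
  have h_id : ∀ x ∈ E, h x = x := fun x hx => hg ⟨x, hx⟩
  have h_C : ∀ x ∈ C, h x = 0 := fun x hx => by
    simp [hh, (Submodule.Quotient.mk_eq_zero C).2 hx]
  have hE_range : E ≤ LinearMap.range h := fun x hx => ⟨x, h_id x hx⟩
  have h_range : LinearMap.range h = E := by
    refine le_antisymm (hE.le_of_ge ?_ hE_range) hE_range
    intro K hK hKM
    have h1 : K ⊓ E = ⊥ := hEess (K ⊓ E) inf_le_right
      (eq_bot_iff.2 ((inf_le_inf_right _ inf_le_left).trans hKM.le))
    have h2 : K.comap h ⊓ E = ⊥ := by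
      rw [eq_bot_iff]
      rintro x ⟨hx, hxE⟩
      have hxK : x ∈ K := by simpa [h_id x hxE] using hx
      have : x ∈ K ⊓ E := ⟨hxK, hxE⟩
      rwa [h1] at this
    have h3 : K.comap h ≤ C := hC.le_of_ge h2 (fun x hx => by
      simp [h_C x hx])
    rw [eq_bot_iff]
    intro y hy
    obtain ⟨x, rfl⟩ := hK hy
    simp [h_C x (h3 hy)]
  refine ⟨E, inferInstance, inferInstance,
    f.codRestrict E (fun m => hME (LinearMap.mem_range_self f m)), ?_, ?_, ?_⟩
  · refine ⟨fun X Y _ _ _ _ i hi k => ?_⟩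
    obtain ⟨l, hl⟩ := hI.out i hi (E.subtype ∘ₗ k)
    refine ⟨(h ∘ₗ l).codRestrict E
      (fun y => h_range ▸ LinearMap.mem_range_self h (l y)), fun x => ?_⟩
    apply Subtype.ext
    simp [hl, h_id]
  · intro a b hab
    exact hf (congrArg Subtype.val hab)
  · intro K hK
    have h1 := hEess (K.map E.subtype) (Submodule.map_subtype_le E K) (by
      rw [eq_bot_iff]
      rintro _ ⟨⟨x, hx, rfl⟩, ⟨m, hm⟩⟩
      have hxK : x ∈ K ⊓ LinearMap.range (f.codRestrict E
          (fun m => hME (LinearMap.mem_range_self f m))) := ⟨hx, ⟨m, Subtype.ext hm⟩⟩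
      rw [hK] at hxK
      have hx0 : x = 0 := by simpa using hxK
      simp [hx0])
    exact Submodule.map_injective_of_injective E.injective_subtype (by rw [h1, Submodule.map_bot])

noncomputable section

namespace LocalDuality

/-! ### The injective hull of the residue field and Matlis duality -/

section Matlis

variable (R : Type u) [CommRing R] [IsLocalRing R]

/-- The injective hull `E` of the residue field of a local ring (well defined up to isomorphism;
we fix one). -/
def E : Type u := (exists_isInjectiveHull R (IsLocalRing.ResidueField R)).choose

instance : AddCommGroup (E R) :=
  (exists_isInjectiveHull R (IsLocalRing.ResidueField R)).choose_spec.choose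

instance : Module R (E R) :=
  (exists_isInjectiveHull R (IsLocalRing.ResidueField R)).choose_spec.choose_spec.choose

/-- The embedding of the residue field in its injective hull. -/
def residueFieldToE : IsLocalRing.ResidueField R →ₗ[R] E R :=
  (exists_isInjectiveHull R
    (IsLocalRing.ResidueField R)).choose_spec.choose_spec.choose_spec.choose

theorem isInjectiveHull_E : IsInjectiveHull (residueFieldToE R) :=
  (exists_isInjectiveHull R
    (IsLocalRing.ResidueField R)).choose_spec.choose_spec.choose_spec.choose_spec

variable {R}

/-- The Matlis dual `Hom_R(Ω, E)` of a module over a local ring. -/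
def matlisDual (Ω : ModuleCat.{u} R) : ModuleCat.{u} R :=
  ModuleCat.of R (Ω →ₗ[R] E R)

end Matlis

/-! ### Local cohomology at the maximal ideal, and higher pseudo-canonical modules -/

/-- The Krull dimension of a ring, as a natural number (used for Noetherian local rings only,
whose Krull dimension is finite). -/
def dim (R : Type u) [CommRing R] : ℕ := ((ringKrullDim R).unbotD 0).toNat

theorem coe_dim (R : Type u) [CommRing R] [IsNoetherianRing R] [IsLocalRing R] :
    (dim R : WithBot ℕ∞) = ringKrullDim R := by
  obtain ⟨a, ha⟩ := WithBot.ne_bot_iff_exists.1 (ringKrullDim_ne_bot (R := R))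
  have ha' : a ≠ ⊤ := by
    rintro rfl
    exact ringKrullDim_ne_top (R := R) ha.symm
  obtain ⟨n, rfl⟩ := ENat.ne_top_iff_exists.1 ha'
  rw [dim, ← ha]
  rfl

section Canonical

variable {R : Type u} [CommRing R] [IsLocalRing R]

/-- The local cohomology module `H^i_𝔪(Ω)`, where `𝔪` is the maximal ideal of `R`. -/
def H (Ω : ModuleCat.{u} R) (i : ℕ) : ModuleCat.{u} R :=
  (localCohomology (IsLocalRing.maximalIdeal R) i).obj Ω

/-- Local cohomology at the maximal ideal with an integer degree; it is zero in negative degrees. -/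
def intH (Ω : ModuleCat.{u} R) : ℤ → ModuleCat.{u} R
  | Int.ofNat i => H Ω i
  | Int.negSucc _ => ModuleCat.of R PUnit

/-- The `i`-th higher (pseudo-)canonical module `K^i_R(Ω)`: the Matlis dual of `H^{d-i}_𝔪(Ω)`, where
`d` is the Krull dimension of `R`. -/
def pcan (Ω : ModuleCat.{u} R) (i : ℤ) : ModuleCat.{u} R :=
  matlisDual (intH Ω ((dim R : ℤ) - i))

end Canonical

/-! ### Complete local rings, Gorenstein and Cohen-Macaulay local rings -/

/-- A complete local ring: Noetherian, local, and complete (and separated) in the topology given by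
the powers of its maximal ideal. -/
class IsCompleteLocalRing (R : Type u) [CommRing R] : Prop
    extends IsLocalRing R, IsNoetherianRing R where
  isAdicComplete : IsAdicComplete (IsLocalRing.maximalIdeal R) R

/-- A Gorenstein local ring: a Noetherian local ring that has finite injective dimension as a
module over itself. -/
def IsGorensteinLocal (R : Type u) [CommRing R] : Prop :=
  IsNoetherianRing R ∧ IsLocalRing R ∧ ∃ n : ℕ, HasInjectiveDimensionLE (ModuleCat.of R R) n

/-- A Cohen-Macaulay local ring: a Noetherian local ring with a regular sequence (necessarily
contained in the maximal ideal) whose length is the Krull dimension. -/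
def IsCohenMacaulayLocal (R : Type u) [CommRing R] : Prop :=
  IsNoetherianRing R ∧ IsLocalRing R ∧
    ∃ rs : List R, RingTheory.Sequence.IsRegular R rs ∧
      (rs.length : WithBot ℕ∞) = ringKrullDim R

end LocalDuality

end

/-! # Higher canonical modules under finite morphisms

**Finite morphisms.** For a finite homomorphism `φ : S → R` of local rings, `Hom_S(R, E_S)` is an
injective hull of the residue field of `R` (`LocalDuality.exists_isInjectiveHull_coext`), so that
`Hom_R(Ω, E_R) ≅ Hom_S(Ω, E_S)` by adjunction. Local cohomology with support in an ideal `J` of `S`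
is the direct limit of the modules `Ext(S ⧸ Jᵏ, -)`. By the Artin-Rees lemma it vanishes in positive
degrees on `Hom_S(M, I)`, for `M` finite and `I` injective (`LocalCoh.LExt.subsingleton_hom`). Every
injective `R`-module is a direct summand of some `Hom_S(R, I)` (`LocalCoh.exists_retract_hom`), hence
is acyclic over `S` as well. In degree zero the local cohomology for `J` and that for `J R` both
consist of the torsion elements, and dimension shifting compares them in all degrees
(`LocalCoh.LExt.nonempty_restrictScalars_iso`). Finally, `𝔫 R` has radical `𝔪`.

**The Gorenstein ring.** A complete local ring `R` with residue characteristic `p` contains a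
coefficient ring `V`: a complete local ring with maximal ideal `(p)` and the same residue field
(`CoefficientRing.exists_isCoeffRing`). It is the intersection of subrings that approximate it modulo
powers of `𝔪`. Sending variables to a system of parameters of `R` makes `R` finite over
`A = V⟦X₁, …, X_d⟧` with `d = dim R`. If `p` is nilpotent in `V`, then `A` has dimension `d`;
otherwise the Cayley–Hamilton theorem gives an element `f` in the kernel of `A → R` that is a power
of `p` modulo the variables, and `A ⧸ (f)` has dimension `d`. In either case the variables form a
regular sequence whose quotient `B` is an Artinian local ring with principal maximal ideal, and `B` is
injective over itself (`Module.injective_self_of_maximalIdeal_eq_span`). Hence the ring has finite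
injective dimension (`InjectiveDimension.exists_hasInjectiveDimensionLT_of_surjective`): `B` is a
direct summand of `Hom(B, I)` for an injective module `I`, whose injective dimension is bounded by
induction on the regular sequence, and Nakayama's lemma for `Ext` carries finiteness of the injective
dimension from `B` to the ring. -/

/-! ### Comparison of the two models of Ext -/

noncomputable section

namespace ExtComparison

open Abelian Limits Opposite HomologicalComplex

variable {A : Type u} [CommRing A] {X X' Y : ModuleCat.{u} A}

/-- The map of cochain complexes `Hom(P, Y) ⟶ Hom(P', Y)` induced by a map of chain complexes. -/
def linearYonedaMap {K K' : ChainComplex (ModuleCat.{u} A) ℕ} (φ : K' ⟶ K) (Y : ModuleCat.{u} A) :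
    K.linearYonedaObj A Y ⟶ K'.linearYonedaObj A Y :=
  (unopFunctor _ _).map
    ((((linearYoneda A (ModuleCat.{u} A)).obj Y).rightOp.mapHomologicalComplex _).map φ).op

theorem comp_of_squares {C : Type*} [Category* C] {a a' b b' c c' : C} {e : a ⟶ a'} {p : a ⟶ b}
    {p' : a' ⟶ b'} {k : b ⟶ b'} (h : e ≫ p' = p ≫ k) (q' : c' ≅ b') (q : c ≅ b) {m : c ⟶ c'}
    (h' : m ≫ q'.hom = q.hom ≫ k) : e ≫ p' ≫ q'.inv = (p ≫ q.inv) ≫ m := by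
  rw [reassoc_of% h, Category.assoc]
  congr 1
  rw [Iso.comp_inv_eq, Category.assoc, h', q.inv_hom_id_assoc]

theorem isoExt_naturality {f : X' ⟶ X} (P : ProjectiveResolution X)
    (P' : ProjectiveResolution X') (φ : P'.complex ⟶ P.complex)
    (comm : φ.f 0 ≫ P.π.f 0 = P'.π.f 0 ≫ f) (n : ℕ) :
    (((Ext A (ModuleCat.{u} A) n).map f.op).app Y) ≫ (P'.isoExt n Y).hom =
      (P.isoExt n Y).hom ≫ homologyMap (linearYonedaMap φ Y) n := by
  have h := congrArg Quiver.Hom.unop (P'.isoLeftDerivedObj_inv_naturality f P φ comm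
    ((linearYoneda A (ModuleCat.{u} A)).obj Y).rightOp n)
  have h2 := congrArg Quiver.Hom.unop (homologyOp_hom_naturality (linearYonedaMap φ Y) n)
  have h3 : (((Ext A (ModuleCat.{u} A) n).map f.op).app Y) ≫
      (P'.isoLeftDerivedObj ((linearYoneda A (ModuleCat.{u} A)).obj Y).rightOp n).inv.unop =
      (P.isoLeftDerivedObj ((linearYoneda A (ModuleCat.{u} A)).obj Y).rightOp n).inv.unop ≫
      (homologyMap ((opFunctor _ _).map (linearYonedaMap φ Y).op) n).unop := h
  have h4 : homologyMap (linearYonedaMap φ Y) n ≫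
      ((P'.complex.linearYonedaObj A Y).homologyOp n).hom.unop =
      ((P.complex.linearYonedaObj A Y).homologyOp n).hom.unop ≫
        (homologyMap ((opFunctor _ _).map (linearYonedaMap φ Y).op) n).unop := h2.symm
  exact comp_of_squares h3 ((P'.complex.linearYonedaObj A Y).homologyOp n).unop
    ((P.complex.linearYonedaObj A Y).homologyOp n).unop h4

theorem d_comp_eq_zero (P : ProjectiveResolution X) {n : ℕ}
    {f : P.complex.X n ⟶ Y} (hf : (P.complex.linearYonedaObj A Y).d n (n + 1) f = 0) :
    P.complex.d (n + 1) n ≫ f = 0 := hf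

theorem iCycles_d_apply (P : ProjectiveResolution X) {n : ℕ}
    (z : (P.complex.linearYonedaObj A Y).cycles n) :
    (P.complex.linearYonedaObj A Y).d n (n + 1)
      ((P.complex.linearYonedaObj A Y).iCycles n z) = 0 := by
  rw [← ConcreteCategory.comp_apply, iCycles_d]
  rfl

theorem extMk_eq_zero_iff' (P : ProjectiveResolution X) {n : ℕ} (f : P.complex.X n ⟶ Y)
    (hf : P.complex.d (n + 1) n ≫ f = 0) :
    P.extMk f (n + 1) rfl hf = 0 ↔
      ∃ g : P.complex.X ((ComplexShape.up ℕ).prev n) ⟶ Y,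
        P.complex.d n ((ComplexShape.up ℕ).prev n) ≫ g = f := by
  cases n with
  | succ n => rw [CochainComplex.prev_nat_succ, P.extMk_eq_zero_iff f _ rfl hf n rfl]
  | zero =>
    rw [← P.extEquivCohomologyClass.apply_eq_iff_eq, P.extEquivCohomologyClass_extMk,
      P.extEquivCohomologyClass_zero, CochainComplex.HomComplex.CohomologyClass.mk_eq_zero_iff,
      CochainComplex.HomComplex.Cocycle.toSingleMk_mem_coboundaries_iff _ _ _ _ _ 1 (by simp)]
    have hd : P.complex.d 0 ((ComplexShape.up ℕ).prev 0) = 0 := P.complex.shape _ _ (by simp)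
    have hd' : P.cochainComplex.d (-(0 : ℕ)) 1 = 0 :=
      (P.complex.isZero_extend_X ComplexShape.embeddingDownNat 1 (by
        intro i hi
        change -(i : ℤ) = 1 at hi
        omega)).eq_of_tgt _ _
    simp only [hd, hd', zero_comp]
    refine ⟨fun ⟨_, h⟩ => ⟨0, ?_⟩, fun ⟨_, h⟩ => ⟨0, ?_⟩⟩
    · rw [← cancel_epi (P.cochainComplexXIso (-(0 : ℕ)) 0 rfl).hom, ← h, comp_zero]
    · rw [← h, comp_zero]

/-- The class in `Ext` of a cocycle of `Hom(P, Y)`, for a projective resolution `P`. -/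
def cyclesToExt (P : ProjectiveResolution X) (n : ℕ) :
    (P.complex.linearYonedaObj A Y).cycles n →ₗ[A] Abelian.Ext.{u} X Y n where
  toFun z := P.extMk (show P.complex.X n ⟶ Y from (P.complex.linearYonedaObj A Y).iCycles n z)
    (n + 1) rfl (d_comp_eq_zero P (iCycles_d_apply P z))
  map_add' z w := by
    rw [P.add_extMk]
    congr 1
    exact map_add _ _ _
  map_smul' r z := by
    rw [RingHom.id_apply, Abelian.Ext.smul_eq_comp_mk₀, P.extMk_comp_mk₀]
    congr 1
    rw [Linear.comp_smul, Category.comp_id]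
    exact map_smul _ _ _

theorem exists_iCycles_eq (K : CochainComplex (ModuleCat.{u} A) ℕ) {n : ℕ} (f : K.X n)
    (hf : K.d n (n + 1) f = 0) : ∃ z : K.cycles n, K.iCycles n z = f := by
  let k : ModuleCat.of A A ⟶ K.X n := ModuleCat.ofHom (LinearMap.toSpanSingleton A _ f)
  refine ⟨K.liftCycles k (n + 1) (by simp) (by ext; simpa [k] using hf) (1 : A), ?_⟩
  rw [← ConcreteCategory.comp_apply, liftCycles_i]
  simp [k]

theorem homologyπ_eq_zero_iff (K : CochainComplex (ModuleCat.{u} A) ℕ) {n : ℕ} (z : K.cycles n) :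
    K.homologyπ n z = 0 ↔ ∃ y, K.d ((ComplexShape.up ℕ).prev n) n y = K.iCycles n z := by
  have h1 : (ShortComplex.mk (K.toCycles ((ComplexShape.up ℕ).prev n) n) (K.homologyπ n)
      (by simp)).Exact :=
    ShortComplex.exact_of_g_is_cokernel _ (K.homologyIsCokernel _ _ rfl)
  rw [ShortComplex.moduleCat_exact_iff] at h1
  have hi : Function.Injective (K.iCycles n) := (ModuleCat.mono_iff_injective _).1 inferInstance
  have ht : ∀ y, K.iCycles n (K.toCycles ((ComplexShape.up ℕ).prev n) n y) =
      K.d ((ComplexShape.up ℕ).prev n) n y := fun y => by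
    rw [← ConcreteCategory.comp_apply, toCycles_i]
  constructor
  · intro h
    obtain ⟨y, rfl⟩ := h1 z h
    exact ⟨y, (ht y).symm⟩
  · rintro ⟨y, hy⟩
    obtain rfl : K.toCycles ((ComplexShape.up ℕ).prev n) n y = z := hi ((ht y).trans hy)
    rw [← ConcreteCategory.comp_apply, toCycles_comp_homologyπ]
    rfl

theorem cyclesToExt_surjective (P : ProjectiveResolution X) (n : ℕ) :
    Function.Surjective (cyclesToExt (Y := Y) P n) := by
  intro α
  obtain ⟨f, hf, rfl⟩ := P.extMk_surjective α (n + 1) rfl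
  obtain ⟨z, hz⟩ := exists_iCycles_eq (P.complex.linearYonedaObj A Y) (n := n) f hf
  refine ⟨z, ?_⟩
  subst hz
  rfl

theorem ker_cyclesToExt (P : ProjectiveResolution X) (n : ℕ) :
    LinearMap.ker (cyclesToExt (Y := Y) P n) =
      LinearMap.ker ((P.complex.linearYonedaObj A Y).homologyπ n).hom := by
  ext z
  rw [LinearMap.mem_ker, LinearMap.mem_ker]
  exact (extMk_eq_zero_iff' P _ (d_comp_eq_zero P (iCycles_d_apply P z))).trans
    (homologyπ_eq_zero_iff _ z).symm

/-- The derived functor `Ext` of Mathlib, in terms of which local cohomology is defined, agrees with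
its derived-category `Ext`, which has long exact sequences. -/
def extEquiv (X Y : ModuleCat.{u} A) (n : ℕ) :
    ((_root_.Ext A (ModuleCat.{u} A) n).obj (op X)).obj Y ≃ₗ[A] Abelian.Ext.{u} X Y n :=
  ((projectiveResolution X).isoExt n Y).toLinearEquiv ≪≫ₗ
  (((LinearMap.quotKerEquivOfSurjective
    (((projectiveResolution X).complex.linearYonedaObj A Y).homologyπ n).hom
    ((ModuleCat.epi_iff_surjective _).1 inferInstance)).symm ≪≫ₗ
    Submodule.quotEquivOfEq _ _ (ker_cyclesToExt _ n).symm) ≪≫ₗ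
    LinearMap.quotKerEquivOfSurjective _ (cyclesToExt_surjective _ n))

theorem extEquiv_apply (X Y : ModuleCat.{u} A) (n : ℕ)
    (x : ((_root_.Ext A (ModuleCat.{u} A) n).obj (op X)).obj Y)
    (z : ((projectiveResolution X).complex.linearYonedaObj A Y).cycles n)
    (h : ((projectiveResolution X).isoExt n Y).hom x =
      ((projectiveResolution X).complex.linearYonedaObj A Y).homologyπ n z) :
    extEquiv X Y n x = cyclesToExt _ n z := by
  have h1 : (LinearMap.quotKerEquivOfSurjective
    (((projectiveResolution X).complex.linearYonedaObj A Y).homologyπ n).hom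
    ((ModuleCat.epi_iff_surjective _).1 inferInstance)).symm
      (((projectiveResolution X).isoExt n Y).hom x) = Submodule.Quotient.mk z := by
    rw [LinearEquiv.symm_apply_eq, h]
    rfl
  simp only [extEquiv, LinearEquiv.trans_apply]
  erw [h1]
  rfl

theorem extEquiv_naturality (f : X' ⟶ X) (Y : ModuleCat.{u} A) (n : ℕ)
    (x : ((_root_.Ext A (ModuleCat.{u} A) n).obj (op X)).obj Y) :
    extEquiv X' Y n (((_root_.Ext A (ModuleCat.{u} A) n).map f.op).app Y x) =
      (Abelian.Ext.mk₀ f).comp (extEquiv X Y n x) (zero_add n) := by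
  obtain ⟨z, hz⟩ := (ModuleCat.epi_iff_surjective
    (((projectiveResolution X).complex.linearYonedaObj A Y).homologyπ n)).1 inferInstance
      (((projectiveResolution X).isoExt n Y).hom x)
  have hφ : (ProjectiveResolution.lift f (projectiveResolution X') (projectiveResolution X)).f 0 ≫
      (projectiveResolution X).π.f 0 = (projectiveResolution X').π.f 0 ≫ f :=
    ProjectiveResolution.lift_commutes_zero ..
  let φ : (projectiveResolution X').Hom (projectiveResolution X) f :=
    ⟨ProjectiveResolution.lift f _ _, hφ⟩
  have hnat := isoExt_naturality (Y := Y) (projectiveResolution X) (projectiveResolution X')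
    φ.hom hφ n
  rw [extEquiv_apply X Y n x z hz.symm, extEquiv_apply X' Y n _
    (cyclesMap (linearYonedaMap φ.hom Y) n z)]
  · refine Eq.trans ?_ (ProjectiveResolution.mk₀_comp_extMk _ _ rfl
      (d_comp_eq_zero _ (iCycles_d_apply _ z)) φ).symm
    have : ((projectiveResolution X').complex.linearYonedaObj A Y).iCycles n
        (cyclesMap (linearYonedaMap φ.hom Y) n z) = (linearYonedaMap φ.hom Y).f n
          (((projectiveResolution X).complex.linearYonedaObj A Y).iCycles n z) := by
      rw [← ConcreteCategory.comp_apply, cyclesMap_i]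
      rfl
    simp only [cyclesToExt, LinearMap.coe_mk, AddHom.coe_mk, this]
    rfl
  · rw [← ConcreteCategory.comp_apply, hnat, ConcreteCategory.comp_apply, ← hz,
      ← ConcreteCategory.comp_apply, ← ConcreteCategory.comp_apply, homologyπ_naturality]

end ExtComparison
end

/-! ### Local cohomology as a direct limit of Ext modules -/

noncomputable section

namespace LocalCoh

open Abelian Limits Opposite localCohomology

variable {A : Type u} [CommRing A] (J : Ideal A)

section DirectLimit

variable {F : ℕ ⥤ ModuleCat.{u} A} {G : ℕ → Type u} [∀ t, AddCommGroup (G t)] [∀ t, Module A (G t)]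
  {g : ∀ s t, s ≤ t → G s →ₗ[A] G t} (e : ∀ t, F.obj t ≃ₗ[A] G t)
  (he : ∀ {s t : ℕ} (f : s ⟶ t) (x : F.obj s), e t (F.map f x) = g s t f.le (e s x))

/-- The direct limit of a system of modules, as a cocone over an isomorphic functor. -/
def coconeOfEquiv : Cocone F where
  pt := ModuleCat.of A (Module.DirectLimit G g)
  ι :=
    { app := fun t => ModuleCat.ofHom (Module.DirectLimit.of A ℕ G g t ∘ₗ (e t).toLinearMap)
      naturality := fun s t f => by
        ext x
        change Module.DirectLimit.of A ℕ G g t (e t (F.map f x)) =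
          Module.DirectLimit.of A ℕ G g s (e s x)
        rw [he, Module.DirectLimit.of_f] }

/-- The map out of the direct limit given by a cocone. -/
def descOfEquiv (c : Cocone F) : Module.DirectLimit G g →ₗ[A] c.pt :=
  Module.DirectLimit.lift A ℕ G g
    (fun t => (c.ι.app t).hom ∘ₗ (e t).symm.toLinearMap) fun s t h x => by
      obtain ⟨y, rfl⟩ := (e s).surjective x
      have h1 : (c.ι.app t).hom (F.map (homOfLE h) y) = (c.ι.app s).hom y :=
        congrArg (fun k => k.hom y) (c.w (homOfLE h))
      have h2 := he (homOfLE h) y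
      rw [← LinearEquiv.eq_symm_apply] at h2
      rw [LinearMap.comp_apply, LinearMap.comp_apply, LinearEquiv.coe_coe, LinearEquiv.coe_coe,
        LinearEquiv.symm_apply_apply, ← h1, h2]

theorem descOfEquiv_of (c : Cocone F) (t : ℕ) (x : F.obj t) :
    descOfEquiv e he c (Module.DirectLimit.of A ℕ G g t (e t x)) = (c.ι.app t).hom x := by
  rw [descOfEquiv, Module.DirectLimit.lift_of, LinearMap.comp_apply, LinearEquiv.coe_coe,
    LinearEquiv.symm_apply_apply]

/-- The cocone given by the direct limit is a colimit cocone. -/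
def isColimitCoconeOfEquiv : IsColimit (coconeOfEquiv e he) where
  desc c := ModuleCat.ofHom (X := Module.DirectLimit G g) (descOfEquiv e he c)
  fac c t := by
    ext x
    exact descOfEquiv_of e he c t x
  uniq c m hm := by
    apply ModuleCat.hom_ext
    apply Module.DirectLimit.hom_ext
    intro t
    ext x
    obtain ⟨y, rfl⟩ := (e t).surjective x
    refine Eq.trans ?_ (descOfEquiv_of e he c t y).symm
    rw [← hm t]
    rfl

end DirectLimit

/-- The module `A / J ^ t`. -/
abbrev powQuot (t : ℕ) : ModuleCat.{u} A := ModuleCat.of A (A ⧸ J ^ t)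

/-- The projection `A / J ^ t ⟶ A / J ^ s` for `s ≤ t`. -/
def powQuotMap {s t : ℕ} (h : s ≤ t) : powQuot J t ⟶ powQuot J s :=
  (ringModIdeals (idealPowersDiagram J)).map (homOfLE h).op

@[simp]
theorem powQuotMap_refl (t : ℕ) : powQuotMap J (le_refl t) = 𝟙 _ :=
  (ringModIdeals (idealPowersDiagram J)).map_id _

@[simp]
theorem powQuotMap_comp {s t r : ℕ} (h : s ≤ t) (h' : t ≤ r) :
    powQuotMap J h' ≫ powQuotMap J h = powQuotMap J (h.trans h') :=
  ((ringModIdeals (idealPowersDiagram J)).map_comp (homOfLE h').op (homOfLE h).op).symm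

/-- The transition maps of the system `t ↦ Ext^i(A / J ^ t, M)`. -/
def extTrans (M : ModuleCat.{u} A) (i : ℕ) (s t : ℕ) (h : s ≤ t) :
    Abelian.Ext.{u} (powQuot J s) M i →ₗ[A] Abelian.Ext.{u} (powQuot J t) M i :=
  (Abelian.Ext.mk₀ (powQuotMap J h)).precompOfLinear A M (zero_add i)

theorem extTrans_apply {M : ModuleCat.{u} A} {i s t : ℕ} (h : s ≤ t)
    (x : Abelian.Ext.{u} (powQuot J s) M i) :
    extTrans J M i s t h x = (Abelian.Ext.mk₀ (powQuotMap J h)).comp x (zero_add i) := rfl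

instance (M : ModuleCat.{u} A) (i : ℕ) :
    DirectedSystem (fun t => Abelian.Ext.{u} (powQuot J t) M i)
      (fun s t h => extTrans J M i s t h) where
  map_self t x := by simp [extTrans_apply]
  map_map s t r h h' x := by
    rw [extTrans_apply, extTrans_apply, extTrans_apply, ← powQuotMap_comp J h h',
      ← Abelian.Ext.mk₀_comp_mk₀_assoc]

/-- The direct limit of the modules `Ext^i(A / J ^ t, M)`, for Mathlib's derived-category `Ext`. -/
abbrev LExt (M : ModuleCat.{u} A) (i : ℕ) : Type u :=
  Module.DirectLimit (fun t => Abelian.Ext.{u} (powQuot J t) M i) (extTrans J M i)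

/-- The class in the direct limit of an element of `Ext^i(A / J ^ t, M)`. -/
abbrev LExt.of (M : ModuleCat.{u} A) (i t : ℕ) :
    Abelian.Ext.{u} (powQuot J t) M i →ₗ[A] LExt J M i :=
  Module.DirectLimit.of A ℕ (fun t => Abelian.Ext.{u} (powQuot J t) M i) (extTrans J M i) t

/-- The system defining local cohomology in Mathlib, evaluated at `M`. -/
abbrev extDiagram (M : ModuleCat.{u} A) (i : ℕ) : ℕᵒᵖᵒᵖ ⥤ ModuleCat.{u} A :=
  diagram (idealPowersDiagram J) i ⋙ (evaluation _ _).obj M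

/-- Local cohomology is the direct limit of the modules `Ext^i(A / J ^ t, M)`. -/
def localCohomologyIso (M : ModuleCat.{u} A) (i : ℕ) :
    (localCohomology J i).obj M ≅ ModuleCat.of A (LExt J M i) :=
  colimitObjIsoColimitCompEvaluation (diagram (idealPowersDiagram J) i) M ≪≫
    (Functor.Final.colimitIso (opOp ℕ) (extDiagram J M i)).symm ≪≫
    (colimit.isColimit _).coconePointUniqueUpToIso
      (isColimitCoconeOfEquiv (fun t => ExtComparison.extEquiv (powQuot J t) M i)
        (fun f x => ExtComparison.extEquiv_naturality (powQuotMap J f.le) M i x))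

variable {J}

theorem LExt.exists_of {M : ModuleCat.{u} A} {i : ℕ} (x : LExt J M i) :
    ∃ t y, LExt.of J M i t y = x :=
  Module.DirectLimit.exists_of x

theorem LExt.subsingleton_iff {M : ModuleCat.{u} A} {i : ℕ} :
    Subsingleton (LExt J M i) ↔ ∀ (t : ℕ) (x : Abelian.Ext.{u} (powQuot J t) M i),
      ∃ s h, extTrans J M i t s h x = 0 := by
  constructor
  · intro h t x
    exact Module.DirectLimit.of.zero_exact (Subsingleton.elim (LExt.of J M i t x) 0)
  · intro h
    refine subsingleton_of_forall_eq 0 fun x => ?_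
    obtain ⟨t, y, rfl⟩ := LExt.exists_of x
    obtain ⟨s, hs, hy⟩ := h t y
    rw [← Module.DirectLimit.of_f (hij := hs), hy, map_zero]

theorem extTrans_comp {M N : ModuleCat.{u} A} {i j k s t : ℕ} (h : s ≤ t)
    (x : Abelian.Ext.{u} (powQuot J s) M i) (α : Abelian.Ext.{u} M N k) (hk : i + k = j) :
    extTrans J N j s t h (x.comp α hk) = (extTrans J M i s t h x).comp α hk := by
  simp only [extTrans_apply]
  rw [Abelian.Ext.comp_assoc _ _ _ (zero_add i) hk (by omega)]

/-- Composition with a class in `Ext^k(M, N)`. -/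
def LExt.post {M N : ModuleCat.{u} A} {i j k : ℕ} (α : Abelian.Ext.{u} M N k) (hk : i + k = j) :
    LExt J M i →ₗ[A] LExt J N j :=
  Module.DirectLimit.map (fun t => α.postcompOfLinear A (powQuot J t) hk)
    (fun s t h => by
      ext x
      exact (extTrans_comp h x α hk).symm)

@[simp]
theorem LExt.post_of {M N : ModuleCat.{u} A} {i j k : ℕ} (α : Abelian.Ext.{u} M N k)
    (hk : i + k = j) {t : ℕ} (x : Abelian.Ext.{u} (powQuot J t) M i) :
    LExt.post (J := J) α hk (LExt.of J M i t x) = LExt.of J N j t (x.comp α hk) :=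
  Module.DirectLimit.map_apply_of _ _ _

section ShortExact

variable {X : ShortComplex (ModuleCat.{u} A)} (hX : X.ShortExact)

theorem LExt.connecting_surjective {i : ℕ} [Subsingleton (LExt J X.X₂ (i + 1))] :
    Function.Surjective (LExt.post (J := J) hX.extClass (rfl : i + 1 = i + 1)) := by
  intro y
  obtain ⟨t, y, rfl⟩ := LExt.exists_of y
  obtain ⟨s, hs, hy⟩ := LExt.subsingleton_iff.1 ‹_› t
    (y.comp (Abelian.Ext.mk₀ X.f) (add_zero _))
  rw [extTrans_comp] at hy
  obtain ⟨x, hx⟩ := Abelian.Ext.covariant_sequence_exact₁ _ hX _ hy rfl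
  refine ⟨LExt.of J _ _ s x, ?_⟩
  rw [LExt.post_of, hx, Module.DirectLimit.of_f]

theorem LExt.ker_connecting {i : ℕ} :
    LinearMap.ker (LExt.post (J := J) hX.extClass (rfl : i + 1 = i + 1)) =
      LinearMap.range (LExt.post (J := J) (Abelian.Ext.mk₀ X.g) (add_zero i)) := by
  ext x
  constructor
  · intro hx
    obtain ⟨t, x, rfl⟩ := LExt.exists_of x
    rw [LinearMap.mem_ker, LExt.post_of] at hx
    obtain ⟨s, hs, hy⟩ := Module.DirectLimit.of.zero_exact hx
    rw [extTrans_comp] at hy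
    obtain ⟨y, hy⟩ := Abelian.Ext.covariant_sequence_exact₃ _ hX _ rfl hy
    refine ⟨LExt.of J _ _ s y, ?_⟩
    rw [LExt.post_of, hy, Module.DirectLimit.of_f]
  · rintro ⟨y, rfl⟩
    obtain ⟨t, y, rfl⟩ := LExt.exists_of y
    rw [LinearMap.mem_ker, LExt.post_of, LExt.post_of,
      Abelian.Ext.comp_assoc _ _ _ (add_zero _) (zero_add 1) (by omega),
      hX.comp_extClass, Abelian.Ext.comp_zero, map_zero]

/-- Dimension shifting in positive degrees. -/
def LExt.shift (i : ℕ) [Subsingleton (LExt J X.X₂ (i + 1))]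
    [Subsingleton (LExt J X.X₂ (i + 2))] : LExt J X.X₃ (i + 1) ≃ₗ[A] LExt J X.X₁ (i + 2) :=
  LinearEquiv.ofBijective (LExt.post (J := J) hX.extClass rfl)
    ⟨by
      rw [← LinearMap.ker_eq_bot, LExt.ker_connecting hX, eq_bot_iff]
      rintro _ ⟨y, rfl⟩
      rw [Subsingleton.elim y 0, map_zero]
      exact zero_mem _, LExt.connecting_surjective hX⟩

end ShortExact

theorem LExt.subsingleton_of_injective (M : ModuleCat.{u} A) [Injective M] (i : ℕ) :
    Subsingleton (LExt J M (i + 1)) :=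
  LExt.subsingleton_iff.2 fun t x => ⟨t, le_rfl, by rw [Abelian.Ext.eq_zero_of_injective x, map_zero]⟩

theorem LExt.subsingleton_of_retract {M N : ModuleCat.{u} A} (f : M ⟶ N) (g : N ⟶ M)
    (h : f ≫ g = 𝟙 M) (i : ℕ) [Subsingleton (LExt J N i)] : Subsingleton (LExt J M i) := by
  refine subsingleton_of_forall_eq 0 fun x => ?_
  have : LExt.post (J := J) (Abelian.Ext.mk₀ g) (add_zero i)
      (LExt.post (Abelian.Ext.mk₀ f) (add_zero i) x) = x := by
    obtain ⟨t, x, rfl⟩ := LExt.exists_of x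
    rw [LExt.post_of, LExt.post_of, Abelian.Ext.comp_assoc _ _ _ (add_zero _) (zero_add 0) (by omega),
      Abelian.Ext.mk₀_comp_mk₀, h, Abelian.Ext.comp_mk₀_id]
  rw [← this, Subsingleton.elim (LExt.post _ _ x) 0, map_zero]

variable (J) in
/-- The submodule of the elements killed by a power of the ideal `J`. -/
def powTorsion (M : Type*) [AddCommGroup M] [Module A M] : Submodule A M where
  carrier := {x | ∃ t : ℕ, ∀ a ∈ J ^ t, a • x = 0}
  add_mem' := by
    rintro x y ⟨s, hs⟩ ⟨t, ht⟩
    refine ⟨max s t, fun a ha => ?_⟩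
    rw [smul_add, hs a (Ideal.pow_le_pow_right (le_max_left _ _) ha),
      ht a (Ideal.pow_le_pow_right (le_max_right _ _) ha), add_zero]
  zero_mem' := ⟨0, fun a _ => smul_zero a⟩
  smul_mem' := by
    rintro c x ⟨t, ht⟩
    exact ⟨t, fun a ha => by rw [smul_comm, ht a ha, smul_zero]⟩

/-- Evaluation at `1`, from `Ext^0(A / J ^ t, M) = Hom(A / J ^ t, M)` to `M`. -/
def evalOne (M : ModuleCat.{u} A) (t : ℕ) : Abelian.Ext.{u} (powQuot J t) M 0 →ₗ[A] M where
  toFun x := (Abelian.Ext.linearEquiv₀ (R := A) x) (Submodule.Quotient.mk 1)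
  map_add' x y := by rw [map_add]; rfl
  map_smul' r x := by rw [map_smul]; rfl

theorem evalOne_mk₀ {M : ModuleCat.{u} A} {t : ℕ} (f : powQuot J t ⟶ M) :
    evalOne M t (Abelian.Ext.mk₀ f) = f (Submodule.Quotient.mk 1) := by
  have : Abelian.Ext.linearEquiv₀ (R := A) (Abelian.Ext.mk₀ f) = f :=
    Abelian.Ext.linearEquiv₀ (R := A).symm.injective (by
      rw [LinearEquiv.symm_apply_apply]; rfl)
  simp only [evalOne, LinearMap.coe_mk, AddHom.coe_mk, this]

theorem evalOne_injective (M : ModuleCat.{u} A) (t : ℕ) :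
    Function.Injective (evalOne (J := J) M t) := by
  intro x y h
  obtain ⟨f, rfl⟩ := (Abelian.Ext.mk₀_bijective _ _).2 x
  obtain ⟨g, rfl⟩ := (Abelian.Ext.mk₀_bijective _ _).2 y
  rw [evalOne_mk₀, evalOne_mk₀] at h
  congr 1
  refine ModuleCat.hom_ext (Submodule.linearMap_qext _ (LinearMap.ext_ring ?_))
  exact h

theorem range_evalOne (M : ModuleCat.{u} A) (t : ℕ) (x : M) :
    x ∈ LinearMap.range (evalOne (J := J) M t) ↔ ∀ a ∈ J ^ t, a • x = 0 := by
  constructor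
  · rintro ⟨x, rfl⟩ a ha
    obtain ⟨f, rfl⟩ := (Abelian.Ext.mk₀_bijective _ _).2 x
    rw [evalOne_mk₀, ← map_smul, ← Submodule.Quotient.mk_smul, smul_eq_mul, mul_one,
      (Submodule.Quotient.mk_eq_zero _).2 ha, map_zero]
  · intro h
    refine ⟨Abelian.Ext.mk₀ (ModuleCat.ofHom ((J ^ t).liftQ (LinearMap.toSpanSingleton A M x)
      fun a ha => h a ha)), ?_⟩
    rw [evalOne_mk₀]
    exact one_smul A x

theorem evalOne_extTrans {M : ModuleCat.{u} A} {s t : ℕ} (h : s ≤ t)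
    (x : Abelian.Ext.{u} (powQuot J s) M 0) :
    evalOne M t (extTrans J M 0 s t h x) = evalOne M s x := by
  obtain ⟨f, rfl⟩ := (Abelian.Ext.mk₀_bijective _ _).2 x
  rw [extTrans_apply, Abelian.Ext.mk₀_comp_mk₀, evalOne_mk₀, evalOne_mk₀]
  rfl

variable (J) in
/-- The map from local cohomology in degree `0` to the module. -/
def LExt.eval (M : ModuleCat.{u} A) : LExt J M 0 →ₗ[A] M :=
  Module.DirectLimit.lift A ℕ _ _ (evalOne M) fun _ _ h x => evalOne_extTrans h x

@[simp]
theorem LExt.eval_of {M : ModuleCat.{u} A} {t : ℕ} (x : Abelian.Ext.{u} (powQuot J t) M 0) :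
    LExt.eval J M (LExt.of J M 0 t x) = evalOne M t x :=
  Module.DirectLimit.lift_of _ _ _

theorem LExt.eval_injective (M : ModuleCat.{u} A) : Function.Injective (LExt.eval J M) :=
  Module.DirectLimit.lift_injective _ _ (evalOne_injective M)

theorem LExt.range_eval (M : ModuleCat.{u} A) : LinearMap.range (LExt.eval J M) =
    powTorsion J M := by
  ext x
  constructor
  · rintro ⟨y, rfl⟩
    obtain ⟨t, y, rfl⟩ := LExt.exists_of y
    exact ⟨t, (range_evalOne M t _).1 ⟨y, (LExt.eval_of y).symm⟩⟩
  · rintro ⟨t, ht⟩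
    obtain ⟨y, rfl⟩ := (range_evalOne M t x).2 ht
    exact ⟨LExt.of J M 0 t y, LExt.eval_of y⟩

theorem LExt.eval_post {M N : ModuleCat.{u} A} (f : M ⟶ N) (x : LExt J M 0) :
    LExt.eval J N (LExt.post (Abelian.Ext.mk₀ f) (add_zero 0) x) = f (LExt.eval J M x) := by
  obtain ⟨t, x, rfl⟩ := LExt.exists_of x
  obtain ⟨g, rfl⟩ := (Abelian.Ext.mk₀_bijective _ _).2 x
  rw [LExt.post_of, Abelian.Ext.mk₀_comp_mk₀, LExt.eval_of, LExt.eval_of, evalOne_mk₀,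
    evalOne_mk₀]
  rfl

variable (J) in
/-- Local cohomology in degree `0` is the torsion submodule. -/
def LExt.zeroEquiv (M : ModuleCat.{u} A) : LExt J M 0 ≃ₗ[A] powTorsion J M :=
  LinearEquiv.ofInjective _ (LExt.eval_injective M) ≪≫ₗ
    LinearEquiv.ofEq _ _ (LExt.range_eval M)

theorem LExt.zeroEquiv_apply (M : ModuleCat.{u} A) (x : LExt J M 0) :
    (LExt.zeroEquiv J M x : M) = LExt.eval J M x := rfl

variable (J) in
/-- The torsion elements of `N` that lift to torsion elements of `M`. -/
abbrev liftable {M N : ModuleCat.{u} A} (g : M ⟶ N) : Submodule A (powTorsion J N) :=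
  ((powTorsion J M).map g.hom).comap (powTorsion J N).subtype

/-- Dimension shifting from degree `0` to degree `1`. -/
def LExt.oneEquiv {X : ShortComplex (ModuleCat.{u} A)} (hX : X.ShortExact)
    [Subsingleton (LExt J X.X₂ 1)] :
    LExt J X.X₁ 1 ≃ₗ[A] powTorsion J X.X₃ ⧸ liftable J X.g :=
  (LinearMap.quotKerEquivOfSurjective (LExt.post (J := J) hX.extClass (rfl : 0 + 1 = 1))
    (LExt.connecting_surjective hX)).symm ≪≫ₗ
    Submodule.Quotient.equiv _ _ (LExt.zeroEquiv J X.X₃) (by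
      rw [LExt.ker_connecting hX]
      ext y
      constructor
      · rintro ⟨_, ⟨x, rfl⟩, rfl⟩
        exact ⟨_, (LExt.zeroEquiv J X.X₂ x).2, (LExt.eval_post X.g x).symm⟩
      · rintro ⟨x, hx, hxy⟩
        obtain ⟨x', hx'⟩ := (LExt.zeroEquiv J X.X₂).surjective ⟨x, hx⟩
        refine ⟨_, ⟨x', rfl⟩, Subtype.ext ?_⟩
        refine (LExt.eval_post X.g x').trans ?_
        rw [← LExt.zeroEquiv_apply, hx']
        exact hxy)

end LocalCoh
end

noncomputable section

namespace LocalCoh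

/-! ### Acyclicity of `Hom` into an injective module -/

section Hom

variable {A : Type u} [CommRing A] (J : Ideal A)
variable {M : Type u} [AddCommGroup M] [Module A M] {I : Type u} [AddCommGroup I] [Module A I]

/-- For `M` finite and `A` Noetherian, a map to an injective module from a submodule `K` of `M`
that is killed by a power of `J` extends to a map on `M` killed by a power of `J`. -/
theorem exists_powTorsion_extension [IsNoetherianRing A] [Module.Finite A M] [Module.Injective A I]
    (K : Submodule A M) (g : K →ₗ[A] I) (hg : g ∈ powTorsion J (K →ₗ[A] I)) :
    ∃ h ∈ powTorsion J (M →ₗ[A] I), h ∘ₗ K.subtype = g := by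
  obtain ⟨t, ht⟩ := hg
  obtain ⟨k, hk⟩ := Ideal.exists_pow_inf_eq_pow_smul J K
  -- by Artin-Rees, `g` vanishes on `K ∩ J ^ (t + k) M`
  set N : Submodule A M := J ^ (t + k) • ⊤ with hN
  have hg0 : ∀ x : K, (x : M) ∈ N → g x = 0 := by
    intro x hx
    have h1 : (x : M) ∈ J ^ t • K := by
      have h2 : (x : M) ∈ J ^ (t + k - k) • (J ^ k • ⊤ ⊓ K) := by
        rw [← hk (t + k) (by omega)]
        exact ⟨hx, x.2⟩
      rw [Nat.add_sub_cancel] at h2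
      exact Submodule.smul_mono le_rfl inf_le_right h2
    have h3 : x ∈ J ^ t • (⊤ : Submodule A K) := by
      have h4 : (x : M) ∈ (J ^ t • (⊤ : Submodule A K)).map K.subtype := by
        rwa [Submodule.map_smul'', Submodule.map_top, Submodule.range_subtype]
      obtain ⟨y, hy, hyx⟩ := h4
      rwa [← Subtype.ext hyx]
    refine Submodule.smul_induction_on h3 (fun a ha y _ => ?_) fun y z hy hz => by
      rw [map_add, hy, hz, add_zero]
    rw [map_smul]
    exact LinearMap.congr_fun (ht a ha) y
  let p : K →ₗ[A] M ⧸ N := N.mkQ ∘ₗ K.subtype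
  have hp : LinearMap.ker p ≤ LinearMap.ker g := fun x hx =>
    hg0 x (by simpa [p] using hx)
  obtain ⟨h, hh⟩ := Module.Injective.out (Q := I)
    ((LinearMap.ker p).liftQ p le_rfl) (by
      rw [← LinearMap.ker_eq_bot]; exact Submodule.ker_liftQ_eq_bot _ _ _ le_rfl)
    ((LinearMap.ker p).liftQ g hp)
  refine ⟨h ∘ₗ N.mkQ, ⟨t + k, fun a ha => ?_⟩, ?_⟩
  · ext x
    have : N.mkQ (a • x) = 0 :=
      (Submodule.Quotient.mk_eq_zero N).2 (Submodule.smul_mem_smul ha Submodule.mem_top)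
    simp only [LinearMap.smul_apply, LinearMap.comp_apply, LinearMap.zero_apply]
    rw [← map_smul, ← map_smul, this, map_zero]
  · ext x
    exact hh ((LinearMap.ker p).mkQ x)

variable {F : Type u} [AddCommGroup F] [Module A F]

variable (I) in
/-- The short complex obtained by applying `Hom(-, I)` to `ker f → F → M`. -/
abbrev homComplex (f : F →ₗ[A] M) : ShortComplex (ModuleCat.{u} A) :=
  ModuleCat.shortComplexOfCompEqZero (LinearMap.lcomp A I f)
    (LinearMap.lcomp A I (LinearMap.ker f).subtype) (by
      ext g x
      change g (f x) = 0
      rw [x.2, map_zero])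

theorem homComplex_shortExact [Module.Injective A I] {f : F →ₗ[A] M}
    (hf : Function.Surjective f) : (homComplex I f).ShortExact := by
  refine ModuleCat.shortComplex_shortExact _ (fun g => ⟨fun hg => ?_, ?_⟩) ?_ fun g => ?_
  · have hg' : LinearMap.ker f ≤ LinearMap.ker g := fun x hx =>
      LinearMap.congr_fun hg ⟨x, hx⟩
    refine ⟨(LinearMap.ker f).liftQ g hg' ∘ₗ
      (f.quotKerEquivOfSurjective hf).symm.toLinearMap, LinearMap.ext fun x => ?_⟩
    change (LinearMap.ker f).liftQ g hg' ((f.quotKerEquivOfSurjective hf).symm (f x)) = g x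
    rw [← f.quotKerEquivOfSurjective_apply_mk hf, LinearEquiv.symm_apply_apply]
    rfl
  · rintro ⟨k, rfl⟩
    exact LinearMap.ext fun x => (congrArg k x.2).trans (map_zero k)
  · intro a b hab
    refine LinearMap.ext fun y => ?_
    obtain ⟨x, rfl⟩ := hf y
    exact LinearMap.congr_fun hab x
  · obtain ⟨h, hh⟩ := Module.Injective.out (Q := I) (LinearMap.ker f).subtype
      (LinearMap.ker f).injective_subtype g
    exact ⟨h, LinearMap.ext hh⟩

theorem LExt.subsingleton_hom_free [Module.Injective A I] (n i : ℕ) :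
    Subsingleton (LExt J (ModuleCat.of A ((Fin n → A) →ₗ[A] I)) (i + 1)) := by
  let e : ((Fin n → A) →ₗ[A] I) ≃ₗ[A] (Fin n → I) := (Module.piEquiv (Fin n) A I).symm
  have : Module.Injective A ((Fin n → A) →ₗ[A] I) :=
    Module.Injective.of_ringEquiv (RingEquiv.refl A) e.symm
  have := Module.injective_object_of_injective_module A ((Fin n → A) →ₗ[A] I)
  exact LExt.subsingleton_of_injective _ i

/-- Local cohomology vanishes in positive degrees on `Hom(M, I)` for `M` finite and `I` injective,
over a Noetherian ring. -/
theorem LExt.subsingleton_hom [IsNoetherianRing A] [Module.Injective A I] (i : ℕ) :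
    ∀ (M : Type u) [AddCommGroup M] [Module A M] [Module.Finite A M],
      Subsingleton (LExt J (ModuleCat.of A (M →ₗ[A] I)) (i + 1)) := by
  induction i with
  | zero =>
    intro M _ _ _
    obtain ⟨n, f, hf⟩ := Module.Finite.exists_fin' A M
    have hX := homComplex_shortExact (I := I) hf
    have : Subsingleton (LExt J (homComplex I f).X₂ 1) := LExt.subsingleton_hom_free J n 0
    have h : liftable J (homComplex I f).g = ⊤ := by
      rw [eq_top_iff]
      rintro ⟨g, hg⟩ -
      obtain ⟨h, hh, hhg⟩ := exists_powTorsion_extension J (LinearMap.ker f) g hg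
      exact ⟨h, hh, hhg⟩
    have : Subsingleton (powTorsion J (homComplex I f).X₃ ⧸ liftable J (homComplex I f).g) :=
      Submodule.Quotient.subsingleton_iff.2 h
    exact (LExt.oneEquiv hX).toEquiv.subsingleton
  | succ i ih =>
    intro M _ _ _
    obtain ⟨n, f, hf⟩ := Module.Finite.exists_fin' A M
    have hX := homComplex_shortExact (I := I) hf
    have : Subsingleton (LExt J (homComplex I f).X₂ (i + 1)) := LExt.subsingleton_hom_free J n i
    have : Subsingleton (LExt J (homComplex I f).X₂ (i + 2)) :=
      LExt.subsingleton_hom_free J n (i + 1)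
    have : Subsingleton (LExt J (homComplex I f).X₃ (i + 1)) := ih (LinearMap.ker f)
    exact (LExt.shift (J := J) hX i).symm.toEquiv.subsingleton

end Hom

/-! ### Local cohomology and restriction of scalars -/

section RestrictScalars

variable {S R : Type u} [CommRing S] [CommRing R] (φ : S →+* R)

/-- A bijective semilinear map is an isomorphism onto the restriction of scalars. -/
def restrictScalarsIso {M : Type u} [AddCommGroup M] [Module S M] {N : Type u} [AddCommGroup N]
    [Module R N] (f : M →ₛₗ[φ] N) (hf : Function.Bijective f) :
    (ModuleCat.restrictScalars φ).obj (ModuleCat.of R N) ≅ ModuleCat.of S M :=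
  (LinearEquiv.ofBijective (M := M) (M₂ := (ModuleCat.restrictScalars φ).obj (ModuleCat.of R N))
    ({ toFun := f, map_add' := f.map_add, map_smul' := f.map_smulₛₗ } :
      M →ₗ[S] (ModuleCat.restrictScalars φ).obj (ModuleCat.of R N)) hf).toModuleIso.symm

theorem mapQ_bijective {M N : Type*} [AddCommGroup M] [Module S M] [AddCommGroup N] [Module R N]
    (f : M →ₛₗ[φ] N) (hf : Function.Bijective f) (p : Submodule S M) (q : Submodule R N)
    (h : p = q.comap f) : Function.Bijective (Submodule.mapQ p q f h.le) := by
  constructor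
  · rw [← LinearMap.ker_eq_bot, eq_bot_iff]
    intro x hx
    obtain ⟨x, rfl⟩ := Submodule.Quotient.mk_surjective _ x
    rw [LinearMap.mem_ker, Submodule.mapQ_apply, Submodule.Quotient.mk_eq_zero] at hx
    rw [Submodule.mem_bot, Submodule.Quotient.mk_eq_zero, h]
    exact hx
  · intro y
    obtain ⟨y, rfl⟩ := Submodule.Quotient.mk_surjective _ y
    obtain ⟨x, rfl⟩ := hf.2 y
    exact ⟨Submodule.Quotient.mk x, rfl⟩

variable (J : Ideal S)

theorem mem_powTorsion_restrictScalars (M : ModuleCat.{u} R) (x : M) :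
    x ∈ powTorsion J ((ModuleCat.restrictScalars φ).obj M) ↔ x ∈ powTorsion (J.map φ) M := by
  constructor
  · rintro ⟨t, ht⟩
    refine ⟨t, fun a ha => ?_⟩
    rw [← Ideal.map_pow] at ha
    refine Submodule.span_induction (p := fun a _ => a • x = 0) ?_ (zero_smul _ _) ?_ ?_ ha
    · rintro _ ⟨s, hs, rfl⟩
      exact ht s hs
    · intro a b _ _ ha hb
      rw [add_smul, ha, hb, add_zero]
    · intro a b _ hb
      rw [smul_eq_mul, mul_smul, hb, smul_zero]
  · rintro ⟨t, ht⟩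
    refine ⟨t, fun a ha => ht (φ a) ?_⟩
    rw [← Ideal.map_pow]
    exact Ideal.mem_map_of_mem φ ha

/-- The identity map between the torsion submodules of a module and of its restriction. -/
def powTorsionRestrict (M : ModuleCat.{u} R) :
    powTorsion J ((ModuleCat.restrictScalars φ).obj M) →ₛₗ[φ] powTorsion (J.map φ) M where
  toFun x := ⟨x.1, (mem_powTorsion_restrictScalars φ J M x.1).1 x.2⟩
  map_add' _ _ := rfl
  map_smul' _ _ := rfl

theorem powTorsionRestrict_bijective (M : ModuleCat.{u} R) :
    Function.Bijective (powTorsionRestrict φ J M) :=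
  ⟨fun _ _ h => Subtype.ext
      (congrArg (fun z : powTorsion (J.map φ) M => (z : M)) h),
    fun x => ⟨⟨x.1, (mem_powTorsion_restrictScalars φ J M x.1).2 x.2⟩, rfl⟩⟩

variable {φ}

variable (φ) in
/-- The restriction of scalars of an injective module is a direct summand of `Hom(R, I)` with `I`
injective. -/
theorem exists_retract_hom (Q : ModuleCat.{u} R) [Injective Q] :
    ∃ (I : Type u) (_ : AddCommGroup I) (_ : Module S I), Module.Injective S I ∧
      Nonempty (Retract ((ModuleCat.restrictScalars φ).obj Q)
        (ModuleCat.of S ((ModuleCat.restrictScalars φ).obj (ModuleCat.of R R) →ₗ[S] I))) := by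
  let I : ModuleCat.{u} S := Injective.under ((ModuleCat.restrictScalars φ).obj Q)
  let f : (ModuleCat.restrictScalars φ).obj Q ⟶ I := Injective.ι _
  have hI' : Injective (ModuleCat.of S I) := inferInstanceAs (Injective (Injective.under _))
  have hf : Function.Injective f.hom := (ModuleCat.mono_iff_injective f).1 inferInstance
  let g : Q ⟶ (ModuleCat.coextendScalars φ).obj I :=
    ModuleCat.RestrictionCoextensionAdj.HomEquiv.fromRestriction φ f
  have hg : Mono g := (ModuleCat.mono_iff_injective _).2 fun x y hxy => by
    have : f.hom ((1 : R) • x : Q) = f.hom ((1 : R) • y : Q) :=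
      LinearMap.congr_fun (congrArg (ModuleCat.CoextendScalars.equiv φ _) hxy) (1 : R)
    rw [one_smul, one_smul] at this
    exact hf this
  let r : Retract Q ((ModuleCat.coextendScalars φ).obj I) :=
    { i := g, r := Injective.factorThru (𝟙 Q) g, retract := Injective.comp_factorThru _ _ }
  let e : (ModuleCat.restrictScalars φ).obj ((ModuleCat.coextendScalars φ).obj I) ≅
      ModuleCat.of S ((ModuleCat.restrictScalars φ).obj (ModuleCat.of R R) →ₗ[S] I) :=
    restrictScalarsIso φ
      { toFun := fun k => (ModuleCat.CoextendScalars.equiv φ I).symm k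
        map_add' := fun _ _ => rfl
        map_smul' := fun a k => by
          apply ModuleCat.CoextendScalars.ext
          refine LinearMap.ext fun (x : R) => ?_
          change a • k x = k (x * φ a)
          exact (k.map_smul a x).symm.trans (congrArg k (mul_comm (φ a) x)) }
      (ModuleCat.CoextendScalars.equiv φ I).symm.bijective
  exact ⟨I, inferInstance, inferInstance, Module.injective_module_of_injective_object S I,
    ⟨(r.map (ModuleCat.restrictScalars φ)).trans (Retract.ofIso e)⟩⟩

/-- For a finite ring map, the restriction of scalars of an injective module is acyclic for local
cohomology. -/
theorem LExt.subsingleton_restrictScalars [IsNoetherianRing S] (hφ : φ.Finite) (Q : ModuleCat.{u} R)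
    [Injective Q] (i : ℕ) :
    Subsingleton (LExt J ((ModuleCat.restrictScalars φ).obj Q) (i + 1)) := by
  obtain ⟨I, _, _, hI, ⟨r⟩⟩ := exists_retract_hom φ Q
  have : Module.Finite S ((ModuleCat.restrictScalars φ).obj (ModuleCat.of R R)) := hφ
  have := LExt.subsingleton_hom J (I := I) i
    ((ModuleCat.restrictScalars φ).obj (ModuleCat.of R R))
  exact LExt.subsingleton_of_retract r.i r.r r.retract _

/-- Local cohomology commutes with restriction of scalars along a finite ring map. -/
theorem LExt.nonempty_restrictScalars_iso [IsNoetherianRing S] (hφ : φ.Finite) (i : ℕ) :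
    ∀ M : ModuleCat.{u} R, Nonempty ((ModuleCat.restrictScalars φ).obj
      (ModuleCat.of R (LExt (J.map φ) M i)) ≅
        ModuleCat.of S (LExt J ((ModuleCat.restrictScalars φ).obj M) i)) := by
  have key (M : ModuleCat.{u} R) : ∃ X : ShortComplex (ModuleCat.{u} R),
      X.X₁ = M ∧ X.ShortExact ∧ (∀ i, Subsingleton (LExt (J.map φ) X.X₂ (i + 1))) ∧
      (X.map (ModuleCat.restrictScalars φ)).ShortExact ∧
      ∀ i, Subsingleton (LExt J (X.map (ModuleCat.restrictScalars φ)).X₂ (i + 1)) := by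
    let X := ShortComplex.mk (Injective.ι M) (Limits.cokernel.π (Injective.ι M))
      (Limits.cokernel.condition _)
    have hX : X.ShortExact :=
      { exact := ShortComplex.exact_of_g_is_cokernel _ (Limits.cokernelIsCokernel _)
        mono_f := inferInstanceAs (Mono (Injective.ι M))
        epi_g := inferInstanceAs (Epi (Limits.cokernel.π _)) }
    have : Injective X.X₂ := inferInstanceAs (Injective (Injective.under M))
    exact ⟨X, rfl, hX, LExt.subsingleton_of_injective _, hX.map_of_exact _,
      LExt.subsingleton_restrictScalars J hφ _⟩
  induction i with
  | zero =>
    intro M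
    exact ⟨(ModuleCat.restrictScalars φ).mapIso (LExt.zeroEquiv (J.map φ) M).toModuleIso ≪≫
      restrictScalarsIso φ _ (powTorsionRestrict_bijective φ J M) ≪≫
      (LExt.zeroEquiv J ((ModuleCat.restrictScalars φ).obj M)).symm.toModuleIso⟩
  | succ i ih =>
    intro M
    obtain ⟨X, rfl, hX, h2, hY, h2'⟩ := key M
    set Y := X.map (ModuleCat.restrictScalars φ) with hYX
    cases i with
    | zero =>
      have := h2 0
      have := h2' 0
      have hl : liftable J Y.g =
          (liftable (J.map φ) X.g).comap (powTorsionRestrict φ J X.X₃) := by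
        ext x
        constructor
        · rintro ⟨y, hy, hyx⟩
          exact ⟨y, (mem_powTorsion_restrictScalars φ J X.X₂ y).1 hy, hyx⟩
        · rintro ⟨y, hy, hyx⟩
          exact ⟨y, (mem_powTorsion_restrictScalars φ J X.X₂ y).2 hy, hyx⟩
      have hb : Function.Bijective (Submodule.mapQ (liftable J Y.g) (liftable (J.map φ) X.g)
          (powTorsionRestrict φ J X.X₃) hl.le) :=
        mapQ_bijective φ _ (powTorsionRestrict_bijective φ J X.X₃) _ _ hl
      exact ⟨(ModuleCat.restrictScalars φ).mapIso (LExt.oneEquiv hX).toModuleIso ≪≫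
        restrictScalarsIso φ _ hb ≪≫ (LExt.oneEquiv hY).symm.toModuleIso⟩
    | succ i =>
      obtain ⟨e⟩ := ih X.X₃
      have := h2 i
      have := h2 (i + 1)
      have := h2' i
      have := h2' (i + 1)
      exact ⟨(ModuleCat.restrictScalars φ).mapIso (LExt.shift hX i).symm.toModuleIso ≪≫
        e ≪≫ (LExt.shift hY i).toModuleIso⟩

end RestrictScalars

end LocalCoh
end

noncomputable section

/-! ### Injective hulls of residue fields -/

section Hull

variable {R : Type u} [CommRing R]

/-- Injective hulls are unique up to isomorphism. -/
theorem IsInjectiveHull.nonempty_linearEquiv {M E E' : Type u} [AddCommGroup M] [Module R M]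
    [AddCommGroup E] [Module R E] [AddCommGroup E'] [Module R E'] {f : M →ₗ[R] E}
    {f' : M →ₗ[R] E'} (hf : IsInjectiveHull f) (hf' : IsInjectiveHull f') :
    Nonempty (E ≃ₗ[R] E') := by
  obtain ⟨g, hg⟩ := hf'.injective_module.out f hf.injective_map f'
  have hg0 : Function.Injective g := by
    rw [← LinearMap.ker_eq_bot]
    refine hf.essential _ (eq_bot_iff.2 ?_)
    rintro _ ⟨hx, m, rfl⟩
    have h0 : f' m = 0 := (hg m).symm.trans hx
    rw [Submodule.mem_bot, hf'.injective_map (h0.trans (map_zero f').symm), map_zero]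
  obtain ⟨r, hr⟩ := hf.injective_module.out g hg0 LinearMap.id
  have hr0 : Function.Injective r := by
    rw [← LinearMap.ker_eq_bot]
    refine hf'.essential _ (eq_bot_iff.2 ?_)
    rintro _ ⟨hx, m, rfl⟩
    have h0 : f m = 0 := by
      rw [SetLike.mem_coe, LinearMap.mem_ker, ← hg, hr] at hx
      exact hx
    rw [Submodule.mem_bot, hf.injective_map (h0.trans (map_zero f).symm), map_zero]
  exact ⟨(LinearEquiv.ofBijective r ⟨hr0, fun x => ⟨g x, hr x⟩⟩).symm⟩

variable [IsLocalRing R] {E : Type u} [AddCommGroup E] [Module R E]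
  {f : IsLocalRing.ResidueField R →ₗ[R] E}

theorem residueField_smul_eq_zero {a : R} (ha : a ∈ IsLocalRing.maximalIdeal R)
    (x : IsLocalRing.ResidueField R) : a • x = 0 := by
  rw [Algebra.smul_def, IsLocalRing.ResidueField.algebraMap_eq,
    (IsLocalRing.residue_eq_zero_iff a).2 ha, zero_mul]

/-- The elements of the injective hull of the residue field that are killed by the maximal ideal
are those of the residue field. -/
theorem IsInjectiveHull.mem_range_of_forall_smul_eq_zero (hf : IsInjectiveHull f) {x : E}
    (hx : ∀ a ∈ IsLocalRing.maximalIdeal R, a • x = 0) : x ∈ LinearMap.range f := by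
  by_cases h0 : x = 0
  · rw [h0]; exact zero_mem _
  have h1 : Submodule.span R {x} ⊓ LinearMap.range f ≠ ⊥ := fun h =>
    h0 (Submodule.span_singleton_eq_bot.1 (hf.essential _ h))
  obtain ⟨y, ⟨hy, hyf⟩, hy0⟩ := Submodule.exists_mem_ne_zero_of_ne_bot h1
  obtain ⟨s, rfl⟩ := Submodule.mem_span_singleton.1 hy
  have hs : IsUnit s := by
    by_contra hs
    exact hy0 (hx s ((IsLocalRing.mem_maximalIdeal s).2 hs))
  obtain ⟨s, rfl⟩ := hs
  have := Submodule.smul_mem _ (↑s⁻¹ : R) hyf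
  rwa [smul_smul, Units.inv_mul, one_smul] at this

/-- Over a Noetherian local ring, each element of the injective hull of the residue field is killed
by a power of the maximal ideal. -/
theorem IsInjectiveHull.exists_pow_smul_eq_zero [IsNoetherianRing R] (hf : IsInjectiveHull f)
    (x : E) : ∃ t : ℕ, ∀ a ∈ IsLocalRing.maximalIdeal R ^ t, a • x = 0 := by
  set m := IsLocalRing.maximalIdeal R
  let M : Submodule R E := Submodule.span R {x}
  let K : Submodule R M := (LinearMap.range f).comap M.subtype
  obtain ⟨k, hk⟩ := Ideal.exists_pow_inf_eq_pow_smul m K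
  have h1 : m ^ (k + 1) • ⊤ ⊓ K = ⊥ := by
    rw [hk (k + 1) (by omega), Nat.add_sub_cancel_left, pow_one, eq_bot_iff]
    refine Submodule.smul_le.2 fun a ha y hy => ?_
    obtain ⟨z, hz⟩ := hy.2
    refine Subtype.ext ?_
    change a • (y : E) = 0
    rw [← show f z = y from hz, ← map_smul, residueField_smul_eq_zero ha, map_zero]
  have h2 : (m ^ (k + 1) • (⊤ : Submodule R M)).map M.subtype = ⊥ := by
    refine hf.essential _ (eq_bot_iff.2 ?_)
    rintro _ ⟨⟨y, hy, rfl⟩, hyf⟩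
    have : y ∈ m ^ (k + 1) • (⊤ : Submodule R M) ⊓ K := ⟨hy, hyf⟩
    rw [h1] at this
    rw [Submodule.mem_bot, (Submodule.mem_bot R).1 this, map_zero]
  refine ⟨k + 1, fun a ha => ?_⟩
  have h3 : a • x ∈ (m ^ (k + 1) • (⊤ : Submodule R M)).map M.subtype :=
    ⟨a • ⟨x, Submodule.mem_span_singleton_self x⟩,
      Submodule.smul_mem_smul ha Submodule.mem_top, rfl⟩
  rwa [h2] at h3

end Hull

namespace LocalDuality

variable {S R : Type u} [CommRing S] [CommRing R] (φ : S →+* R)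

/-! ### Matlis duality and finite ring maps -/

section Coextension

variable (N : Type u) [AddCommGroup N] [Module S N]

/-- The `R`-module `Hom_S(R, N)`. -/
def Coext : Type u := (ModuleCat.coextendScalars φ).obj (ModuleCat.of S N)

instance : AddCommGroup (Coext φ N) :=
  inferInstanceAs (AddCommGroup ((ModuleCat.coextendScalars φ).obj (ModuleCat.of S N)))

instance : Module R (Coext φ N) :=
  inferInstanceAs (Module R ((ModuleCat.coextendScalars φ).obj (ModuleCat.of S N)))

variable {N}

/-- Evaluation of an element of `Hom_S(R, N)`. -/
def Coext.eval (c : Coext φ N) (r : R) : N :=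
  ModuleCat.CoextendScalars.equiv φ (ModuleCat.of S N) c r

/-- The element of `Hom_S(R, N)` given by an `S`-linear function. -/
def Coext.mk (f : R →+ N) (hf : ∀ (s : S) (r : R), f (φ s * r) = s • f r) : Coext φ N :=
  (ModuleCat.CoextendScalars.equiv φ (ModuleCat.of S N)).symm
    { toFun := fun r : R => f r, map_add' := fun x y => f.map_add x y, map_smul' := hf }

variable {φ}

theorem Coext.ext {c d : Coext φ N} (h : ∀ r, c.eval φ r = d.eval φ r) : c = d :=
  ModuleCat.CoextendScalars.ext (LinearMap.ext h)

theorem Coext.eval_smul (a : R) (c : Coext φ N) (r : R) :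
    (a • c).eval φ r = c.eval φ (r * a) := rfl

theorem Coext.eval_map_mul (s : S) (c : Coext φ N) (r : R) :
    c.eval φ (φ s * r) = s • c.eval φ r :=
  (ModuleCat.CoextendScalars.equiv φ (ModuleCat.of S N) c).map_smul s r

theorem Coext.eval_add_right (c : Coext φ N) (r r' : R) :
    c.eval φ (r + r') = c.eval φ r + c.eval φ r' :=
  (ModuleCat.CoextendScalars.equiv φ (ModuleCat.of S N) c).map_add r r'

theorem Coext.injective_module (hN : Module.Injective S N) : Module.Injective R (Coext φ N) := by
  have : Injective (ModuleCat.of S N) := Module.injective_object_of_injective_module S N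
  have : Injective (ModuleCat.of R (Coext φ N)) :=
    Injective.injective_of_adjoint (ModuleCat.restrictCoextendScalarsAdj φ) (ModuleCat.of S N)
  exact Module.injective_module_of_injective_object R _

variable (φ) in
/-- The adjunction between restriction and coextension of scalars, as a semilinear map. -/
def toCoext (Ω : ModuleCat.{u} R) :
    ((ModuleCat.restrictScalars φ).obj Ω →ₗ[S] N) →ₛₗ[φ] (Ω →ₗ[R] Coext φ N) where
  toFun h :=
    { toFun := fun x => Coext.mk φ (N := N)
        { toFun := fun r => h (r • x : Ω)
          map_zero' := (congrArg h (zero_smul R x)).trans (map_zero h)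
          map_add' := fun r r' => (congrArg h (add_smul r r' x)).trans (map_add h _ _) }
        fun s r => (congrArg h (mul_smul (φ s) r x)).trans (h.map_smul s (r • x : Ω))
      map_add' := fun x y => Coext.ext fun r =>
        (congrArg h (smul_add r x y)).trans (map_add h _ _)
      map_smul' := fun a x => Coext.ext fun r => congrArg h (smul_smul r a x) }
  map_add' _ _ := rfl
  map_smul' s h := LinearMap.ext fun x => Coext.ext fun r => by
    change s • h (r • x : Ω) = h ((r * φ s) • x : Ω)
    rw [mul_comm, mul_smul]
    exact (h.map_smul s (r • x : Ω)).symm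

theorem toCoext_bijective (Ω : ModuleCat.{u} R) :
    Function.Bijective (toCoext φ (N := N) Ω) := by
  constructor
  · intro h h' hh
    refine LinearMap.ext fun x => ?_
    have : h ((1 : R) • x : Ω) = h' ((1 : R) • x : Ω) :=
      congrArg (fun c => Coext.eval φ c 1) (LinearMap.congr_fun hh x)
    rwa [one_smul] at this
  · intro g
    refine ⟨{ toFun := fun x => (g x).eval φ 1
              map_add' := fun x y => ?_
              map_smul' := fun s x => ?_ }, LinearMap.ext fun x => Coext.ext fun r => ?_⟩
    · exact congrArg (fun c => Coext.eval φ c 1) (map_add g x y)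
    · refine (congrArg (fun c => Coext.eval φ c 1) (map_smul g (φ s) x)).trans ?_
      rw [Coext.eval_smul, mul_comm, Coext.eval_map_mul]
      rfl
    · refine (congrArg (fun c => Coext.eval φ c 1) (map_smul g r x)).trans ?_
      rw [Coext.eval_smul, one_mul]

end Coextension

section Local

variable [IsLocalRing S] [IsLocalRing R] {φ}

theorem comap_maximalIdeal_of_finite (hφ : φ.Finite) :
    (IsLocalRing.maximalIdeal R).comap φ = IsLocalRing.maximalIdeal S :=
  IsLocalRing.eq_maximalIdeal
    (Ideal.isMaximal_comap_of_isIntegral_of_isMaximal' φ hφ.to_isIntegral _)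

theorem radical_map_maximalIdeal_of_finite (hφ : φ.Finite) :
    ((IsLocalRing.maximalIdeal S).map φ).radical = IsLocalRing.maximalIdeal R := by
  apply le_antisymm
  · refine Ideal.IsPrime.radical_le_iff (inferInstance) |>.2 ?_
    rw [Ideal.map_le_iff_le_comap, comap_maximalIdeal_of_finite hφ]
  · rw [Ideal.radical_eq_sInf]
    refine le_sInf ?_
    rintro P ⟨hP, hP'⟩
    have h1 : P.comap φ = IsLocalRing.maximalIdeal S :=
      ((IsLocalRing.maximalIdeal.isMaximal S).eq_of_le (hP'.comap φ).ne_top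
        (Ideal.map_le_iff_le_comap.1 hP)).symm
    have := Ideal.isMaximal_of_isIntegral_of_isMaximal_comap' φ hφ.to_isIntegral P
      (h1 ▸ IsLocalRing.maximalIdeal.isMaximal S)
    exact (IsLocalRing.eq_maximalIdeal this).ge

variable [IsNoetherianRing S] [IsNoetherianRing R]

/-- The module `Hom_S(R, E_S)` is an injective hull of the residue field of `R`: its elements are
killed by powers of the maximal ideal, and its socle is the dual of the residue field of `R` over
that of `S`, a line over the former. -/
theorem exists_isInjectiveHull_coext (hφ : φ.Finite) :
    ∃ f : IsLocalRing.ResidueField R →ₗ[R] Coext φ (E S), IsInjectiveHull f := by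
  let _ : Algebra S R := φ.toAlgebra
  have : Module.Finite S R := hφ
  have : IsLocalHom (algebraMap S R) := ⟨fun a ha => by
    by_contra h
    have h1 : a ∈ IsLocalRing.maximalIdeal S := (IsLocalRing.mem_maximalIdeal a).2 h
    rw [← comap_maximalIdeal_of_finite hφ] at h1
    exact (IsLocalRing.mem_maximalIdeal _).1 h1 ha⟩
  set m := IsLocalRing.maximalIdeal R with hm
  set n := IsLocalRing.maximalIdeal S with hn
  let k := IsLocalRing.ResidueField S
  let l := IsLocalRing.ResidueField R
  have : Module.Finite k l := inferInstance
  have : IsScalarTower S k l := inferInstance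
  have hmul (s : S) (r : R) (a : l) : (φ s * r) • a = s • r • a := by
    rw [mul_smul]
    exact algebraMap_smul R s (r • a)
  -- a functional `c` on `l` with `c 1 ≠ 0`; the form `(a, b) ↦ c (a * b)` is nondegenerate
  obtain ⟨c, hc⟩ : ∃ c : Module.Dual k l, c 1 ≠ 0 := by
    by_contra! h
    exact one_ne_zero ((Module.forall_dual_apply_eq_zero_iff k (1 : l)).1 h)
  let Ψ : l →ₗ[k] Module.Dual k l := (LinearMap.mul k l).compr₂ c
  have hΨ : Function.Injective Ψ := by
    rw [← LinearMap.ker_eq_bot, eq_bot_iff]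
    intro a ha
    by_contra ha0
    have h1 : c (a * a⁻¹) = 0 := LinearMap.congr_fun ha a⁻¹
    rw [mul_inv_cancel₀ ha0] at h1
    exact hc h1
  have hΨ' : Function.Surjective Ψ :=
    (LinearMap.injective_iff_surjective_of_finrank_eq_finrank
      Subspace.dual_finrank_eq.symm).1 hΨ
  let ι : k →ₗ[S] E S := residueFieldToE S
  have hι := isInjectiveHull_E S
  let f : l →ₗ[R] Coext φ (E S) :=
    { toFun := fun a => Coext.mk φ
        { toFun := fun r => ι (c (r • a))
          map_zero' := by rw [zero_smul, map_zero, map_zero]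
          map_add' := fun r r' => by rw [add_smul, map_add, map_add] }
        fun s r => by
          change ι (c ((φ s * r) • a)) = s • ι (c (r • a))
          rw [hmul, LinearMap.map_smul_of_tower, map_smul]
      map_add' := fun a b => Coext.ext fun r => by
        change ι (c (r • (a + b))) = ι (c (r • a)) + ι (c (r • b))
        rw [smul_add, map_add, map_add]
      map_smul' := fun a b => Coext.ext fun r => by
        change ι (c (r • a • b)) = ι (c ((r * a) • b))
        rw [mul_smul] }
  have hf (a : l) (r : R) : (f a).eval φ r = ι (c (r • a)) := rfl
  refine ⟨f, Coext.injective_module hι.injective_module, ?_, fun K hK => ?_⟩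
  · intro a b hab
    apply hΨ
    refine LinearMap.ext fun x => ?_
    obtain ⟨r, rfl⟩ := IsLocalRing.residue_surjective x
    have h1 : ι (c (r • a)) = ι (c (r • b)) := by rw [← hf, ← hf, hab]
    have h2 := hι.injective_map h1
    rw [Algebra.smul_def, Algebra.smul_def, mul_comm, mul_comm _ b] at h2
    exact h2
  -- a nonzero submodule `K` contains a nonzero element `y` of the socle, which lies in the image
  by_contra hK0
  obtain ⟨x, hx, hx0⟩ := Submodule.exists_mem_ne_zero_of_ne_bot hK0
  have htors : ∃ t : ℕ, ∀ a ∈ m ^ t, a • x = 0 := by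
    -- the values of `x` lie in a finite module, hence are killed by one power of `n`
    have h1 : ∀ N : Submodule S R, N.FG → ∃ t : ℕ, ∀ s ∈ n ^ t, ∀ r ∈ N, s • x.eval φ r = 0 := by
      intro N hN
      refine Submodule.fg_induction (motive := fun N _ => ∃ t : ℕ, ∀ s ∈ n ^ t, ∀ r ∈ N,
        s • x.eval φ r = 0) ?_ ?_ N hN
      · intro r
        obtain ⟨t, ht⟩ := hι.exists_pow_smul_eq_zero (x.eval φ r)
        refine ⟨t, fun s hs r' hr' => ?_⟩
        obtain ⟨s', rfl⟩ := Submodule.mem_span_singleton.1 hr'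
        rw [Algebra.smul_def]
        refine (congrArg (s • ·) (x.eval_map_mul s' r)).trans ?_
        rw [smul_comm, ht s hs, smul_zero]
      · rintro N₁ N₂ - - ⟨t₁, h₁⟩ ⟨t₂, h₂⟩
        refine ⟨max t₁ t₂, fun s hs r hr => ?_⟩
        obtain ⟨r₁, hr₁, r₂, hr₂, rfl⟩ := Submodule.mem_sup.1 hr
        rw [Coext.eval_add_right, smul_add,
          h₁ s (Ideal.pow_le_pow_right (le_max_left _ _) hs) r₁ hr₁,
          h₂ s (Ideal.pow_le_pow_right (le_max_right _ _) hs) r₂ hr₂, add_zero]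
    obtain ⟨t, ht⟩ := h1 ⊤ Module.Finite.fg_top
    obtain ⟨N, hN⟩ := Ideal.exists_radical_pow_le_of_fg (n.map φ) (IsNoetherian.noetherian _)
    rw [radical_map_maximalIdeal_of_finite hφ] at hN
    refine ⟨N * t, fun a ha => ?_⟩
    have ha' : a ∈ (n ^ t).map φ := by
      rw [Ideal.map_pow]
      rw [pow_mul] at ha
      exact Ideal.pow_right_mono hN t ha
    refine Submodule.span_induction (p := fun a _ => a • x = 0) ?_ (zero_smul _ _) ?_ ?_ ha'
    · rintro _ ⟨s, hs, rfl⟩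
      refine Coext.ext fun r => ?_
      rw [Coext.eval_smul, mul_comm, Coext.eval_map_mul]
      exact ht s hs r trivial
    · intro a b _ _ ha hb
      rw [add_smul, ha, hb, add_zero]
    · intro a b _ hb
      rw [smul_eq_mul, mul_smul, hb, smul_zero]
  classical
  let t := Nat.find htors
  have ht : ∀ a ∈ m ^ t, a • x = 0 := Nat.find_spec htors
  have ht0 : t ≠ 0 := fun h0 => hx0 (by
    rw [← one_smul R x]
    exact ht 1 (by rw [h0, pow_zero, Ideal.one_eq_top]; trivial))
  obtain ⟨a, ha, hax⟩ : ∃ a ∈ m ^ (t - 1), a • x ≠ 0 := by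
    by_contra! h
    exact Nat.find_min htors (Nat.sub_one_lt ht0) h
  set y := a • x with hy
  have hym : ∀ b ∈ m, b • y = 0 := fun b hb => by
    rw [hy, smul_smul]
    refine ht _ ?_
    rw [← Nat.sub_add_cancel (Nat.one_le_iff_ne_zero.2 ht0), pow_succ']
    exact Ideal.mul_mem_mul hb ha
  have hy1 (r : R) : y.eval φ r ∈ LinearMap.range ι :=
    hι.mem_range_of_forall_smul_eq_zero fun s hs => by
      have hs' : φ s ∈ m := by
        rwa [← comap_maximalIdeal_of_finite hφ] at hs
      rw [← Coext.eval_map_mul, mul_comm, ← Coext.eval_smul, hym _ hs']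
      rfl
  have hy2 (r : R) (hr : r ∈ m) : y.eval φ r = 0 := by
    rw [← one_mul r, ← Coext.eval_smul, hym _ hr]
    rfl
  let y' : R →ₗ[S] LinearMap.range ι :=
    { toFun := fun r => ⟨y.eval φ r, hy1 r⟩
      map_add' := fun r r' => Subtype.ext (y.eval_add_right r r')
      map_smul' := fun s r => Subtype.ext (by
        rw [Algebra.smul_def]
        exact y.eval_map_mul s r) }
  let z : l →ₗ[S] k := (LinearEquiv.ofInjective ι hι.injective_map).symm.toLinearMap ∘ₗ
    (m.restrictScalars S).liftQ y' fun r hr => Subtype.ext (hy2 r hr)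
  have hz (r : R) : ι (z (IsLocalRing.residue R r)) = y.eval φ r :=
    congrArg Subtype.val ((LinearEquiv.ofInjective ι hι.injective_map).apply_symm_apply (y' r))
  obtain ⟨b, hb⟩ := hΨ' (z.extendScalarsOfSurjective (IsLocalRing.residue_surjective))
  have hyb : f b = y := Coext.ext fun r => by
    rw [hf, ← hz]
    congr 1
    have := LinearMap.congr_fun hb (IsLocalRing.residue R r)
    rw [Algebra.smul_def, mul_comm]
    exact this
  have : y ∈ K ⊓ LinearMap.range f := ⟨K.smul_mem a hx, b, hyb⟩
  rw [hK] at this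
  exact hax this

/-- Matlis duality commutes with restriction of scalars. -/
theorem nonempty_restrictScalars_matlisDual_iso (hφ : φ.Finite) (Ω : ModuleCat.{u} R) :
    Nonempty ((ModuleCat.restrictScalars φ).obj (matlisDual Ω) ≅
      matlisDual ((ModuleCat.restrictScalars φ).obj Ω)) := by
  obtain ⟨f, hf⟩ := exists_isInjectiveHull_coext hφ
  obtain ⟨e⟩ := (isInjectiveHull_E R).nonempty_linearEquiv hf
  exact ⟨(ModuleCat.restrictScalars φ).mapIso (e.congrRight (M := Ω)).toModuleIso ≪≫
    LocalCoh.restrictScalarsIso φ _ (toCoext_bijective Ω)⟩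

theorem nonempty_restrictScalars_H_iso (hφ : φ.Finite) (Ω : ModuleCat.{u} R) (i : ℕ) :
    Nonempty ((ModuleCat.restrictScalars φ).obj (H Ω i) ≅
      H ((ModuleCat.restrictScalars φ).obj Ω) i) := by
  obtain ⟨e⟩ := LocalCoh.LExt.nonempty_restrictScalars_iso (IsLocalRing.maximalIdeal S) hφ i Ω
  have h : (IsLocalRing.maximalIdeal R).radical =
      ((IsLocalRing.maximalIdeal S).map φ).radical := by
    rw [radical_map_maximalIdeal_of_finite hφ, Ideal.IsPrime.radical inferInstance]
  exact ⟨(ModuleCat.restrictScalars φ).mapIso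
    ((localCohomology.isoOfSameRadical h i).app Ω ≪≫ LocalCoh.localCohomologyIso _ Ω i) ≪≫ e ≪≫
    (LocalCoh.localCohomologyIso _ _ i).symm⟩

theorem nonempty_restrictScalars_intH_iso (hφ : φ.Finite) (Ω : ModuleCat.{u} R) (i : ℤ) :
    Nonempty ((ModuleCat.restrictScalars φ).obj (intH Ω i) ≅
      intH ((ModuleCat.restrictScalars φ).obj Ω) i) := by
  cases i with
  | ofNat i => exact nonempty_restrictScalars_H_iso hφ Ω i
  | negSucc i => exact ⟨LocalCoh.restrictScalarsIso φ (M := PUnit) (N := PUnit)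
      { toFun := id, map_add' := fun _ _ => rfl, map_smul' := fun _ _ => rfl }
      Function.bijective_id⟩

theorem nonempty_restrictScalars_pcan_iso (hφ : φ.Finite) (Ω : ModuleCat.{u} R) (r i : ℤ)
    (hr : r = (dim S : ℤ) - (dim R : ℤ)) :
    Nonempty ((ModuleCat.restrictScalars φ).obj (pcan Ω i) ≅
      pcan ((ModuleCat.restrictScalars φ).obj Ω) (r + i)) := by
  obtain ⟨e⟩ := nonempty_restrictScalars_matlisDual_iso hφ (intH Ω ((dim R : ℤ) - i))
  obtain ⟨e'⟩ := nonempty_restrictScalars_intH_iso hφ Ω ((dim R : ℤ) - i)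
  have h : (dim S : ℤ) - (r + i) = (dim R : ℤ) - i := by omega
  rw [pcan, pcan, h]
  exact ⟨e ≪≫ (LinearEquiv.congrLeft (E S) S e'.toLinearEquiv).toModuleIso⟩

end Local

end LocalDuality
end

noncomputable section

/-! ### Coefficient fields of square-zero extensions of fields -/

namespace CoefficientRing

open Polynomial

variable {Q k : Type*} [CommRing Q] [Field k] {π : Q →+* k}

theorem isUnit_of_map_ne_zero (hπ : Function.Surjective π) (h0 : ∀ x, π x = 0 → x ^ 2 = 0)
    {x : Q} (hx : π x ≠ 0) : IsUnit x := by
  obtain ⟨y, hy⟩ := hπ (π x)⁻¹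
  have h1 : (1 - x * y) ^ 2 = 0 := h0 _ (by rw [map_sub, map_one, map_mul, hy,
    mul_inv_cancel₀ hx, sub_self])
  exact IsUnit.of_mul_eq_one (y * (2 - x * y)) (by linear_combination -h1)

/-- A square-zero extension of a field of characteristic `p` contains a coefficient field. By
Zorn's lemma there is a maximal subring meeting the kernel in `0` and containing all `p`-th powers;
the adjunction of a further element satisfies a pure equation of degree `p`, so that it does not
meet the kernel. -/
theorem exists_subring_of_prime (hπ : Function.Surjective π) (h0 : ∀ x, π x = 0 → x ^ 2 = 0)
    {p : ℕ} (hp : p.Prime) (hpQ : (p : Q) = 0) :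
    ∃ A : Subring Q, (∀ y ∈ A, π y = 0 → y = 0) ∧ ∀ x, ∃ y ∈ A, π y = π x := by
  have : Nontrivial Q := π.domain_nontrivial
  have : Fact p.Prime := ⟨hp⟩
  have hQ : CharP Q p := (CharP.ringChar_of_prime_eq_zero hp hpQ) ▸ inferInstance
  have hpk : (p : k) = 0 := by rw [← map_natCast π, hpQ, map_zero]
  have hk : CharP k p := (CharP.ringChar_of_prime_eq_zero hp hpk) ▸ inferInstance
  obtain ⟨A, hA₀, hA⟩ := zorn_le_nonempty₀
    {A : Subring Q | (∀ x, x ^ p ∈ A) ∧ ∀ y ∈ A, π y = 0 → y = 0} (by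
      intro c hc hchain B hB
      refine ⟨sSup c, ⟨fun x => (le_sSup hB) ((hc hB).1 x), fun y hy hy0 => ?_⟩,
        fun z hz => le_sSup hz⟩
      obtain ⟨C, hC, hyC⟩ := (Subring.mem_sSup_of_directedOn ⟨B, hB⟩ hchain.directedOn).1 hy
      exact (hc hC).2 y hyC hy0)
    (frobenius Q p).range ⟨fun x => ⟨x, rfl⟩, by
      rintro _ ⟨x, rfl⟩ hx
      rw [frobenius_def, map_pow] at hx
      rw [frobenius_def, ← Nat.sub_add_cancel hp.two_le, pow_add,
        h0 x (eq_zero_of_pow_eq_zero hx), mul_zero]⟩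
  obtain ⟨hAp, hA0⟩ := hA.prop
  refine ⟨A, hA0, fun x => ?_⟩
  by_contra! hx
  have hfield : IsField A :=
    { exists_pair_ne := ⟨0, 1, zero_ne_one⟩
      mul_comm := mul_comm
      mul_inv_cancel := fun {a} ha => by
        obtain ⟨u, hu⟩ := isUnit_of_map_ne_zero hπ h0
          (fun h => ha (Subtype.ext (hA0 a a.2 h)))
        refine ⟨a ^ (p - 1) * ⟨(↑u⁻¹ : Q) ^ p, hAp _⟩, Subtype.ext ?_⟩
        change (a : Q) * ((a : Q) ^ (p - 1) * (↑u⁻¹ : Q) ^ p) = 1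
        rw [← mul_assoc, ← pow_succ', Nat.sub_add_cancel hp.one_le, ← mul_pow, ← hu,
          Units.mul_inv, one_pow] }
  let _ : Field A := hfield.toField
  let _ : Algebra A k := (π.comp A.subtype).toAlgebra
  let πA : Q →ₐ[A] k := { π with commutes' := fun _ => rfl }
  let a : A := ⟨x ^ p, hAp x⟩
  have hirr : Irreducible (X ^ p - C a : A[X]) := X_pow_sub_C_irreducible_of_prime hp fun b hb => by
    refine hx b b.2 (frobenius_inj k p ?_)
    rw [frobenius_def, frobenius_def, ← map_pow, ← map_pow]
    exact congrArg (fun c : A => π c) hb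
  have hmin : minpoly A (π x) = X ^ p - C a := by
    refine (minpoly.eq_of_irreducible_of_monic hirr ?_ (monic_X_pow_sub_C a hp.ne_zero)).symm
    rw [map_sub, map_pow, aeval_X, aeval_C, ← map_pow]
    exact sub_self _
  have hle : A ≤ (Algebra.adjoin A {x}).toSubring := fun y hy =>
    (Algebra.adjoin A {x}).algebraMap_mem ⟨y, hy⟩
  have hmem : (Algebra.adjoin A {x}).toSubring ∈
      {A : Subring Q | (∀ x, x ^ p ∈ A) ∧ ∀ y ∈ A, π y = 0 → y = 0} := by
    refine ⟨fun y => hle (hAp y), fun y hy hy0 => ?_⟩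
    obtain ⟨f, rfl⟩ : y ∈ (aeval (R := A) x).range := by
      rw [← Algebra.adjoin_singleton_eq_range_aeval]
      exact hy
    have h1 : aeval (π x) f = 0 := (aeval_algHom_apply πA x f).trans hy0
    obtain ⟨g, hg⟩ := minpoly.dvd A (π x) h1
    rw [hmin] at hg
    change aeval x f = 0
    rw [hg, map_mul, map_sub, map_pow, aeval_X, aeval_C]
    exact mul_eq_zero_of_left (sub_self _) _
  exact hx x (hA.le_of_ge hmem hle (Algebra.self_mem_adjoin_singleton A x)) rfl

/-- A square-zero extension of a field of characteristic zero contains a coefficient field, because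
field extensions of `ℚ` are formally smooth. -/
theorem exists_subring_of_charZero [CharZero k] (hπ : Function.Surjective π)
    (h0 : ∀ x y, π x = 0 → π y = 0 → x * y = 0) :
    ∃ A : Subring Q, (∀ y ∈ A, π y = 0 → y = 0) ∧ ∀ x, ∃ y ∈ A, π y = π x := by
  have : Nontrivial Q := π.domain_nontrivial
  obtain ⟨_⟩ : Nonempty (Algebra ℚ Q) := by
    refine (EqualCharZero.nonempty_algebraRat_iff Q).2 fun I hI => charZero_of_inj_zero fun n hn => ?_
    by_contra hn0
    have h1 : π (n : Q) ≠ 0 := by rwa [map_natCast, Nat.cast_ne_zero]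
    have h2 := isUnit_of_map_ne_zero hπ (fun x hx => (pow_two x).trans (h0 x x hx hx)) h1
    rw [← map_natCast (Ideal.Quotient.mk I), Ideal.Quotient.eq_zero_iff_mem] at hn
    exact hI (I.eq_top_of_isUnit_mem hn h2)
  have hN : RingHom.ker π ^ 2 = ⊥ := by
    rw [eq_bot_iff, pow_two, Ideal.mul_le]
    exact fun x hx y hy => h0 x y hx hy
  let πQ : Q →ₐ[ℚ] k := π.toRatAlgHom
  obtain ⟨s, hs⟩ := exists_isTranscendenceBasis ℚ k
  have : Algebra.IsAlgebraic (IntermediateField.adjoin ℚ (Set.range ((↑) : s → k))) k :=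
    hs.isAlgebraic_field
  have : Algebra.FormallySmooth ℚ k :=
    Algebra.FormallySmooth.of_algebraicIndependent_of_isSeparable hs.1
  let σ : k →ₐ[ℚ] Q := Algebra.FormallySmooth.liftOfSurjective (AlgHom.id ℚ k) πQ hπ ⟨2, hN⟩
  have hσ (x : k) : π (σ x) = x :=
    Algebra.FormallySmooth.liftOfSurjective_apply (AlgHom.id ℚ k) πQ hπ ⟨2, hN⟩ x
  refine ⟨σ.toRingHom.range, ?_, fun x => ⟨σ (π x), ⟨_, rfl⟩, hσ _⟩⟩
  rintro _ ⟨y, rfl⟩ hy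
  have : π (σ y) = 0 := hy
  rw [hσ] at this
  rw [this, map_zero]

theorem exists_coefficientField (hπ : Function.Surjective π)
    (h0 : ∀ x y, π x = 0 → π y = 0 → x * y = 0) (p : ℕ) [CharP k p] (hp : (p : Q) = 0) :
    ∃ A : Subring Q, (∀ y ∈ A, π y = 0 → y = 0) ∧ ∀ x, ∃ y ∈ A, π y = π x := by
  rcases CharP.char_is_prime_or_zero k p with h | rfl
  · exact exists_subring_of_prime hπ (fun x hx => (pow_two x).trans (h0 x x hx hx)) h hp
  · have := CharP.charP_to_charZero k
    exact exists_subring_of_charZero hπ h0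

/-! ### Coefficient rings of complete local rings -/

section Approx

variable {R : Type*} [CommRing R] (m : Ideal R) (p : ℕ)

/-- A subring `W` of `R` containing `m ^ n`, which modulo `m ^ n` is a coefficient ring: it maps
onto the residue field, and its elements in `m` are multiples of `p` modulo `m ^ n`. -/
structure IsCoeffApprox (n : ℕ) (W : Subring R) : Prop where
  pow_le : ∀ x ∈ m ^ n, x ∈ W
  exists_sub_mem : ∀ r, ∃ w ∈ W, r - w ∈ m
  exists_eq_mul_add : ∀ w ∈ W, w ∈ m → ∃ v ∈ W, ∃ z ∈ m ^ n, w = p * v + z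

variable {m p}

/-- An approximate coefficient ring can be refined: pass to the preimage of a coefficient field of
its quotient by `p` and `m ^ (n + 1)`, which is a square-zero extension of the residue field. -/
theorem IsCoeffApprox.exists_refinement [m.IsMaximal] [CharP (R ⧸ m) p] {n : ℕ} (hn : 1 ≤ n)
    {W : Subring R} (hW : IsCoeffApprox m p n W) :
    ∃ W' ≤ W, IsCoeffApprox m p (n + 1) W' ∧ ∀ w ∈ W, ∃ w' ∈ W', w - w' ∈ m ^ n := by
  have hpm : (p : R) ∈ m := by
    rw [← Ideal.Quotient.eq_zero_iff_mem, map_natCast, CharP.cast_eq_zero]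
  have hnm : m ^ n ≤ m := Ideal.pow_le_self (by omega)
  let I : Ideal W := Ideal.span {(p : W)} ⊔ (m ^ (n + 1)).comap W.subtype
  have memI {w : R} (hw : w ∈ W) : (⟨w, hw⟩ : W) ∈ I ↔
      ∃ v ∈ W, ∃ z ∈ m ^ (n + 1), w = p * v + z := by
    constructor
    · intro h
      obtain ⟨x, hx, ⟨z, hz⟩, hz', h⟩ := Submodule.mem_sup.1 h
      obtain ⟨⟨v, hv⟩, rfl⟩ := Ideal.mem_span_singleton'.1 hx
      exact ⟨v, hv, z, hz', by rw [mul_comm]; exact (congrArg Subtype.val h).symm⟩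
    · rintro ⟨v, hv, z, hz, rfl⟩
      refine Submodule.mem_sup.2 ⟨p * ⟨v, hv⟩, Ideal.mul_mem_right _ _
        (Ideal.mem_span_singleton_self _), ⟨z, hW.pow_le z (Ideal.pow_le_pow_right
          n.le_succ hz)⟩, hz, rfl⟩
  let _ : Field (R ⧸ m) := Ideal.Quotient.field m
  let π : W ⧸ I →+* R ⧸ m := Ideal.Quotient.lift I ((Ideal.Quotient.mk m).comp W.subtype) (by
    rintro ⟨w, hw⟩ h
    obtain ⟨v, hv, z, hz, rfl⟩ := (memI hw).1 h
    refine Ideal.Quotient.eq_zero_iff_mem.2 (m.add_mem (m.mul_mem_right _ hpm) ?_)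
    exact Ideal.pow_le_self n.succ_ne_zero hz)
  have hπ (w : W) : π (Ideal.Quotient.mk I w) = Ideal.Quotient.mk m (w : R) := rfl
  have hsurj : Function.Surjective π := fun x => by
    obtain ⟨r, rfl⟩ := Ideal.Quotient.mk_surjective x
    obtain ⟨w, hw, hrw⟩ := hW.exists_sub_mem r
    exact ⟨Ideal.Quotient.mk I ⟨w, hw⟩, ((Ideal.Quotient.mk_eq_mk_iff_sub_mem _ _).2 hrw).symm⟩
  obtain ⟨A, hA0, hA⟩ := exists_coefficientField hsurj (fun x y hx hy => by
    obtain ⟨⟨w, hw⟩, rfl⟩ := Ideal.Quotient.mk_surjective x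
    obtain ⟨⟨v, hv⟩, rfl⟩ := Ideal.Quotient.mk_surjective y
    rw [hπ, Ideal.Quotient.eq_zero_iff_mem] at hx hy
    obtain ⟨a, ha, z, hz, hwz⟩ := hW.exists_eq_mul_add w hw hx
    obtain ⟨b, hb, z', hz', hvz⟩ := hW.exists_eq_mul_add v hv hy
    rw [← map_mul, Ideal.Quotient.eq_zero_iff_mem]
    refine (memI (W.mul_mem hw hv)).2 ⟨a * v + z * b, W.add_mem (W.mul_mem ha hv)
      (W.mul_mem (hW.pow_le z hz) hb), z * z', ?_, ?_⟩
    · rw [pow_succ]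
      exact Ideal.mul_mem_mul hz (hnm hz')
    · rw [hwz]
      linear_combination z * hvz) p (by
    rw [← map_natCast (Ideal.Quotient.mk I), Ideal.Quotient.eq_zero_iff_mem]
    exact Ideal.mem_sup_left (Ideal.mem_span_singleton_self _))
  let W' : Subring R := (A.comap (Ideal.Quotient.mk I)).map W.subtype
  have mem_W' {w : R} (hw : w ∈ W) (h : Ideal.Quotient.mk I ⟨w, hw⟩ ∈ A) : w ∈ W' :=
    ⟨⟨w, hw⟩, h, rfl⟩
  have memI_W' {w : R} (hw : w ∈ W) (h : (⟨w, hw⟩ : W) ∈ I) : w ∈ W' := mem_W' hw (by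
    rw [Ideal.Quotient.eq_zero_iff_mem.2 h]
    exact A.zero_mem)
  have hW'W : W' ≤ W := by
    rintro _ ⟨w, -, rfl⟩
    exact w.2
  have happrox : ∀ w ∈ W, ∃ w' ∈ W', w - w' ∈ m ^ n := by
    intro w hw
    obtain ⟨y, hyA, hy⟩ := hA (Ideal.Quotient.mk I ⟨w, hw⟩)
    obtain ⟨⟨v, hv⟩, rfl⟩ := Ideal.Quotient.mk_surjective y
    rw [hπ, hπ, eq_comm, Ideal.Quotient.mk_eq_mk_iff_sub_mem] at hy
    obtain ⟨a, ha, z, hz, hwz⟩ := hW.exists_eq_mul_add _ (W.sub_mem hw hv) hy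
    have hpa : (p : R) * a ∈ W := W.mul_mem (natCast_mem W p) ha
    refine ⟨v + p * a, W'.add_mem (mem_W' hv hyA) (memI_W' hpa ?_), ?_⟩
    · exact (memI hpa).2 ⟨a, ha, 0, zero_mem _, (add_zero _).symm⟩
    · rw [← sub_sub]
      change w - v = _ at hwz
      rw [hwz, add_sub_cancel_left]
      exact hz
  refine ⟨W', hW'W, ⟨fun x hx => ?_, fun r => ?_, fun w hw hwm => ?_⟩, happrox⟩
  · have hxW : x ∈ W := hW.pow_le x (Ideal.pow_le_pow_right n.le_succ hx)
    exact memI_W' hxW ((memI hxW).2 ⟨0, W.zero_mem, x, hx, by rw [mul_zero, zero_add]⟩)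
  · obtain ⟨w, hw, hrw⟩ := hW.exists_sub_mem r
    obtain ⟨w', hw', h⟩ := happrox w hw
    refine ⟨w', hw', ?_⟩
    rw [← sub_add_sub_cancel r w w']
    exact m.add_mem hrw (hnm h)
  · obtain ⟨⟨w, hwW⟩, hwA, rfl⟩ := hw
    have h1 := hA0 _ hwA ((Ideal.Quotient.eq_zero_iff_mem (I := m)).2 hwm)
    obtain ⟨v, hv, z, hz, h⟩ := (memI hwW).1 (Ideal.Quotient.eq_zero_iff_mem.1 h1)
    obtain ⟨v', hv', hvv'⟩ := happrox v hv
    refine ⟨v', hv', p * (v - v') + z, (m ^ (n + 1)).add_mem ?_ hz, ?_⟩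
    · rw [pow_succ']
      exact Ideal.mul_mem_mul hpm hvv'
    · change w = _
      rw [h]
      ring

end Approx

end CoefficientRing

end

noncomputable section

namespace CoefficientRing

section Limits

variable {R : Type*} [CommRing R] {m : Ideal R}

theorem eq_zero_of_forall_mem_pow [IsHausdorff m R] {x : R} (h : ∀ n, x ∈ m ^ n) : x = 0 :=
  IsHausdorff.haus ‹_› x fun n => by
    rw [SModEq.zero, smul_eq_mul, Ideal.mul_top]
    exact h n

theorem exists_limit [IsPrecomplete m R] (f : ℕ → R) (c : ℕ)
    (hf : ∀ n, f n - f (n + 1) ∈ m ^ (n + c)) : ∃ L, ∀ n, f n - L ∈ m ^ (n + c) := by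
  have h1 : ∀ a b, f a - f (a + b) ∈ m ^ (a + c) := by
    intro a b
    induction b with
    | zero => simp
    | succ b ih =>
      rw [← sub_add_sub_cancel _ (f (a + b))]
      exact add_mem ih (Ideal.pow_le_pow_right (by omega) (hf (a + b)))
  obtain ⟨L, hL⟩ := IsPrecomplete.prec (I := m) ‹_› (f := f) fun {a b} hab => by
    obtain ⟨b, rfl⟩ := Nat.exists_eq_add_of_le hab
    rw [SModEq.sub_mem, smul_eq_mul, Ideal.mul_top]
    exact Ideal.pow_le_pow_right (by omega) (h1 a b)
  refine ⟨L, fun n => ?_⟩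
  rw [← sub_add_sub_cancel _ (f (n + c))]
  refine add_mem (h1 n c) ?_
  have := hL (n + c)
  rwa [SModEq.sub_mem, smul_eq_mul, Ideal.mul_top] at this

end Limits

/-- A coefficient ring of a ring complete with respect to a maximal ideal `m`: a closed subring `V`
that maps onto the residue field and whose elements in `m` are, up to any power of `m`, multiples
of the residue characteristic `p`. -/
structure IsCoeffRing {R : Type*} [CommRing R] (m : Ideal R) (p : ℕ) (V : Subring R) : Prop where
  closed : ∀ r, (∀ n, ∃ v ∈ V, r - v ∈ m ^ n) → r ∈ V
  exists_sub_mem : ∀ r, ∃ v ∈ V, r - v ∈ m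
  exists_sub_mul_mem : ∀ v ∈ V, v ∈ m → ∀ n, ∃ u ∈ V, v - p * u ∈ m ^ n

variable {R : Type*} [CommRing R] {m : Ideal R} {p : ℕ}

/-- A complete local ring has a coefficient ring: intersect a decreasing sequence of
approximations. -/
theorem exists_isCoeffRing [m.IsMaximal] [CharP (R ⧸ m) p] [IsPrecomplete m R] :
    ∃ V : Subring R, IsCoeffRing m p V := by
  have hstart : IsCoeffApprox m p 1 (⊤ : Subring R) :=
    ⟨fun _ _ => trivial, fun r => ⟨r, trivial, by rw [sub_self]; exact zero_mem _⟩,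
      fun w _ hw => ⟨0, trivial, w, by rwa [pow_one], by rw [mul_zero, zero_add]⟩⟩
  have hstep (i : ℕ) (W : {W : Subring R // IsCoeffApprox m p (i + 1) W}) :
      ∃ W' : {W : Subring R // IsCoeffApprox m p (i + 2) W}, W'.1 ≤ W.1 ∧
        ∀ w ∈ W.1, ∃ w' ∈ W'.1, w - w' ∈ m ^ (i + 1) := by
    obtain ⟨W', h1, h2, h3⟩ := W.2.exists_refinement (by omega)
    exact ⟨⟨W', h2⟩, h1, h3⟩
  choose next hle happ using hstep
  let W : ∀ i, {W : Subring R // IsCoeffApprox m p (i + 1) W} := fun i =>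
    Nat.rec ⟨⊤, hstart⟩ next i
  have hanti : Antitone fun i => (W i).1 := antitone_nat_of_succ_le fun i => hle i (W i)
  have hclosed (r : R) (h : ∀ n, ∃ v ∈ (⨅ i, (W i).1 : Subring R), r - v ∈ m ^ n) :
      r ∈ (⨅ i, (W i).1 : Subring R) := by
    rw [Subring.mem_iInf]
    intro i
    obtain ⟨v, hv, hrv⟩ := h (i + 1)
    rw [← sub_add_cancel r v]
    exact add_mem ((W i).2.pow_le _ hrv) (Subring.mem_iInf.1 hv i)
  -- elements of the approximations are approximated by elements of the intersection
  have hlim (i : ℕ) (w : R) (hw : w ∈ (W i).1) :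
      ∃ v ∈ (⨅ i, (W i).1 : Subring R), w - v ∈ m ^ (i + 1) := by
    choose g hg hg' using fun (j : ℕ) (x : R) (hx : x ∈ (W j).1) => happ j (W j) x hx
    let f : ∀ j, {x : R // x ∈ (W (i + j)).1} := fun j =>
      Nat.rec ⟨w, hw⟩ (fun j x => ⟨g (i + j) x.1 x.2, hg (i + j) x.1 x.2⟩) j
    obtain ⟨L, hL⟩ := exists_limit (m := m) (fun j => (f j).1) (i + 1) fun j => by
      rw [show j + (i + 1) = i + j + 1 by omega]
      exact hg' (i + j) (f j).1 (f j).2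
    refine ⟨L, Subring.mem_iInf.2 fun j => ?_, by
      have := hL 0
      rwa [zero_add] at this⟩
    have h1 : (f j).1 ∈ (W j).1 := hanti (Nat.le_add_left j i) (f j).2
    have h2 := (W j).2.pow_le _ (Ideal.pow_le_pow_right (by omega) (hL j))
    rw [← sub_sub_cancel (f j).1 L]
    exact sub_mem h1 h2
  refine ⟨⨅ i, (W i).1, hclosed, fun r => ?_, fun v hv hvm n => ?_⟩
  · obtain ⟨v, hv, h⟩ := hlim 0 r trivial
    exact ⟨v, hv, by rwa [zero_add, pow_one] at h⟩
  · obtain ⟨a, ha, z, hz, rfl⟩ := (W n).2.exists_eq_mul_add v (Subring.mem_iInf.1 hv n) hvm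
    obtain ⟨u, hu, hau⟩ := hlim n a ha
    refine ⟨u, hu, Ideal.pow_le_pow_right n.le_succ ?_⟩
    rw [add_sub_right_comm, ← mul_sub]
    exact add_mem (Ideal.mul_mem_left _ _ hau) hz

namespace IsCoeffRing

variable {V : Subring R}

theorem sub_mul_mem_of_pow_notMem [IsLocalRing R] (hV : IsCoeffRing (IsLocalRing.maximalIdeal R) p V)
    {c n : ℕ} (hc : (p : R) ^ c ∉ IsLocalRing.maximalIdeal R ^ n) {v : R} (hv : v ∈ V)
    (hvn : v ∈ IsLocalRing.maximalIdeal R ^ n) (N : ℕ) :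
    ∃ u ∈ V, v - p ^ (c + 1) * u ∈ IsLocalRing.maximalIdeal R ^ N := by
  set m := IsLocalRing.maximalIdeal R
  have key (j : ℕ) (hj : j ≤ c + 1) : ∃ u ∈ V, v - p ^ j * u ∈ m ^ (max n N) := by
    induction j with
    | zero => exact ⟨v, hv, by rw [pow_zero, one_mul, sub_self]; exact zero_mem _⟩
    | succ j ih =>
      obtain ⟨u, hu, hvu⟩ := ih (by omega)
      -- otherwise `p ^ j` would be a multiple of `v` modulo `m ^ n`
      have hum : u ∈ m := by
        by_contra hum
        obtain ⟨w, hw⟩ := IsLocalRing.notMem_maximalIdeal.1 hum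
        refine hc ?_
        have h1 : (p : R) ^ j ∈ m ^ n := by
          have h2 : (p : R) ^ j = (v - (v - p ^ j * u)) * ↑w⁻¹ := by
            rw [sub_sub_cancel, ← hw, mul_assoc, Units.mul_inv, mul_one]
          rw [h2]
          exact Ideal.mul_mem_right _ _ (sub_mem hvn
            (Ideal.pow_le_pow_right (le_max_left _ _) hvu))
        rw [← Nat.sub_add_cancel (show j ≤ c by omega), pow_add]
        exact Ideal.mul_mem_left _ _ h1
      obtain ⟨u', hu', huu'⟩ := hV.exists_sub_mul_mem u hu hum (max n N)
      refine ⟨u', hu', ?_⟩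
      rw [show v - p ^ (j + 1) * u' = (v - p ^ j * u) + p ^ j * (u - p * u') by ring]
      exact add_mem hvu (Ideal.mul_mem_left _ _ huu')
  obtain ⟨u, hu, h⟩ := key (c + 1) le_rfl
  exact ⟨u, hu, Ideal.pow_le_pow_right (le_max_right _ _) h⟩

theorem exists_sub_pow_mul_mem [IsLocalRing R] (hV : IsCoeffRing (IsLocalRing.maximalIdeal R) p V)
    [IsHausdorff (IsLocalRing.maximalIdeal R) R] (c : ℕ) :
    ∃ n, ∀ v ∈ V, v ∈ IsLocalRing.maximalIdeal R ^ n →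
      ∀ N, ∃ u ∈ V, v - p ^ (c + 1) * u ∈ IsLocalRing.maximalIdeal R ^ N := by
  classical
  by_cases h : ∃ c₀, (p : R) ^ c₀ = 0
  · have h0 : (p : R) ^ Nat.find h = 0 := Nat.find_spec h
    have hpos : Nat.find h ≠ 0 := fun h1 => by
      rw [h1, pow_zero] at h0
      exact one_ne_zero h0
    have h1 : (p : R) ^ (Nat.find h - 1) ≠ 0 := Nat.find_min h (Nat.sub_one_lt hpos)
    obtain ⟨n, hn⟩ := not_forall.1 (mt (eq_zero_of_forall_mem_pow
      (m := IsLocalRing.maximalIdeal R)) h1)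
    refine ⟨n, fun v hv hvn N => ⟨0, V.zero_mem, ?_⟩⟩
    obtain ⟨u, -, hvu⟩ := hV.sub_mul_mem_of_pow_notMem hn hv hvn N
    rw [Nat.sub_add_cancel (Nat.one_le_iff_ne_zero.2 hpos), h0, zero_mul, sub_zero] at hvu
    rwa [mul_zero, sub_zero]
  · obtain ⟨n, hn⟩ := not_forall.1 (mt (eq_zero_of_forall_mem_pow
      (m := IsLocalRing.maximalIdeal R)) (fun hc => h ⟨c, hc⟩))
    exact ⟨n, fun v hv hvn N => hV.sub_mul_mem_of_pow_notMem hn hv hvn N⟩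

theorem mem_span_natCast_pow {v : V} {n : ℕ} :
    v ∈ Ideal.span {(p : V)} ^ n ↔ ∃ u ∈ V, (v : R) = p ^ n * u := by
  rw [Ideal.span_singleton_pow, Ideal.mem_span_singleton]
  constructor
  · rintro ⟨u, rfl⟩
    exact ⟨u, u.2, by push_cast; rfl⟩
  · rintro ⟨u, hu, h⟩
    exact ⟨⟨u, hu⟩, Subtype.ext (by rw [h]; push_cast; rfl)⟩

variable [IsLocalRing R] [IsAdicComplete (IsLocalRing.maximalIdeal R) R]

/-- The `p`-adic topology of a coefficient ring is the one induced by the ring. -/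
theorem exists_eq_pow_mul
    (hV : IsCoeffRing (IsLocalRing.maximalIdeal R) p V) (hp : (p : R) ∈ IsLocalRing.maximalIdeal R)
    (c : ℕ) : ∃ n, ∀ v ∈ V, v ∈ IsLocalRing.maximalIdeal R ^ n →
    ∃ u ∈ V, v = p ^ (c + 1) * u := by
  set m := IsLocalRing.maximalIdeal R
  choose n hn using hV.exists_sub_pow_mul_mem
  refine ⟨n c, fun v hv hvn => ?_⟩
  choose! g hgV hg using fun (i : ℕ) (z : R) (hz : z ∈ V ∧ z ∈ m ^ n (c + i)) =>
    hn (c + i) z hz.1 hz.2 (max i (n (c + (i + 1))))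
  -- `z i` is what remains of `v` after the first `i` terms of the series `u`
  let z : ∀ i, {z : R // z ∈ V ∧ z ∈ m ^ n (c + i)} := fun i =>
    Nat.rec ⟨v, hv, hvn⟩ (fun i z => ⟨z.1 - p ^ (c + i + 1) * g i z.1,
      sub_mem z.2.1 (mul_mem (pow_mem (natCast_mem V p) _) (hgV i z.1 z.2)),
      Ideal.pow_le_pow_right (le_max_right _ _) (hg i z.1 z.2)⟩) i
  have hz (i : ℕ) : (z (i + 1)).1 = (z i).1 - p ^ (c + i + 1) * g i (z i).1 := rfl
  have hzm (i : ℕ) : (z (i + 1)).1 ∈ m ^ i :=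
    Ideal.pow_le_pow_right (le_max_left _ _) (hg i (z i).1 (z i).2)
  let s : ℕ → R := fun i => ∑ j ∈ Finset.range i, p ^ j * g j (z j).1
  have hsV (i : ℕ) : s i ∈ V := sum_mem fun j _ =>
    mul_mem (pow_mem (natCast_mem V p) _) (hgV j _ (z j).2)
  obtain ⟨L, hL⟩ := exists_limit (m := m) s 0 fun i => by
    simp only [s, Finset.sum_range_succ]
    rw [sub_add_cancel_left, add_zero]
    exact neg_mem (Ideal.mul_mem_right _ _ (Ideal.pow_mem_pow hp i))
  have hvs (i : ℕ) : v - p ^ (c + 1) * s i = (z i).1 := by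
    induction i with
    | zero => simp [s, z]
    | succ i ih =>
      have hs : s (i + 1) = s i + p ^ i * g i (z i).1 := Finset.sum_range_succ _ _
      rw [hz, hs]
      linear_combination ih
  refine ⟨L, hV.closed L fun i => ⟨s i, hsV i, ?_⟩, sub_eq_zero.1
    (eq_zero_of_forall_mem_pow (m := m) fun i => ?_)⟩
  · rw [← neg_sub]
    exact neg_mem (hL i)
  · rw [show v - p ^ (c + 1) * L = (v - p ^ (c + 1) * s (i + 1)) + p ^ (c + 1) * (s (i + 1) - L) by
      ring, hvs]
    exact add_mem (hzm i) (Ideal.mul_mem_left _ _ (Ideal.pow_le_pow_right (by omega) (hL (i + 1))))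

theorem exists_eq_mul_of_mem
    (hV : IsCoeffRing (IsLocalRing.maximalIdeal R) p V) (hp : (p : R) ∈ IsLocalRing.maximalIdeal R)
    {v : R} (hv : v ∈ V) (hvm : v ∈ IsLocalRing.maximalIdeal R) :
    ∃ u ∈ V, v = p * u := by
  obtain ⟨n, hn⟩ := hV.exists_eq_pow_mul hp 0
  obtain ⟨u, hu, hvu⟩ := hV.exists_sub_mul_mem v hv hvm n
  obtain ⟨w, hw, h⟩ := hn _ (sub_mem hv (mul_mem (natCast_mem V p) hu)) hvu
  exact ⟨u + w, add_mem hu hw, by linear_combination h⟩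

theorem isAdicComplete
    (hV : IsCoeffRing (IsLocalRing.maximalIdeal R) p V) (hp : (p : R) ∈ IsLocalRing.maximalIdeal R) :
    IsAdicComplete (Ideal.span {(p : V)}) V where
  haus' x hx := by
    refine Subtype.ext (eq_zero_of_forall_mem_pow (m := IsLocalRing.maximalIdeal R) fun n => ?_)
    have := hx n
    rw [SModEq.zero, smul_eq_mul, Ideal.mul_top, mem_span_natCast_pow] at this
    obtain ⟨u, -, h⟩ := this
    rw [h]
    exact Ideal.mul_mem_right _ _ (Ideal.pow_mem_pow hp n)
  prec' f hf := by
    have hf' {a b : ℕ} (h : a ≤ b) : f a - f b ∈ Ideal.span {(p : V)} ^ a := by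
      have := hf h
      rwa [SModEq.sub_mem, smul_eq_mul, Ideal.mul_top] at this
    obtain ⟨L, hL⟩ := exists_limit (m := IsLocalRing.maximalIdeal R) (fun n => (f n : R)) 0
      fun n => by
        obtain ⟨u, -, h⟩ := mem_span_natCast_pow.1 (hf' n.le_succ)
        change ((f n - f (n + 1) : V) : R) ∈ _
        rw [h]
        exact Ideal.mul_mem_right _ _ (Ideal.pow_mem_pow hp n)
    have hLV : L ∈ V := hV.closed L fun n => ⟨f n, (f n).2, by
      rw [← neg_sub]
      exact neg_mem (hL n)⟩
    refine ⟨⟨L, hLV⟩, fun n => ?_⟩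
    rw [SModEq.sub_mem, smul_eq_mul, Ideal.mul_top]
    obtain ⟨N, hN⟩ := hV.exists_eq_pow_mul hp n
    have h1 : f (max n N) - ⟨L, hLV⟩ ∈ Ideal.span {(p : V)} ^ n := by
      refine Ideal.pow_le_pow_right n.le_succ (mem_span_natCast_pow.2 (hN _ (Subtype.prop _) ?_))
      exact Ideal.pow_le_pow_right (by omega) (hL (max n N))
    rw [← sub_add_sub_cancel _ (f (max n N))]
    exact add_mem (hf' (le_max_left _ _)) h1

theorem isUnit_of_notMem
    (hV : IsCoeffRing (IsLocalRing.maximalIdeal R) p V) (hp : (p : R) ∈ IsLocalRing.maximalIdeal R)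
    {v : V} (hv : (v : R) ∉ IsLocalRing.maximalIdeal R) : IsUnit v := by
  obtain ⟨w, hw⟩ := IsLocalRing.notMem_maximalIdeal.1 hv
  obtain ⟨u, hu, hwu⟩ := hV.exists_sub_mem (↑w⁻¹ : R)
  have h1 : ((1 - v * ⟨u, hu⟩ : V) : R) ∈ IsLocalRing.maximalIdeal R := by
    have : ((1 - v * ⟨u, hu⟩ : V) : R) = v * (↑w⁻¹ - u) := by
      push_cast
      rw [mul_sub, ← hw, Units.mul_inv]
    rw [this]
    exact Ideal.mul_mem_left _ _ hwu
  obtain ⟨a, ha, h⟩ := hV.exists_eq_mul_of_mem hp (Subtype.prop _) h1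
  have := hV.isAdicComplete hp
  have h2 := IsAdicComplete.le_jacobson_bot (Ideal.span {(p : V)})
    (Ideal.mem_span_singleton_self _)
  have h3 : v * ⟨u, hu⟩ = p * -⟨a, ha⟩ + 1 := Subtype.ext (by
    have := h
    push_cast at this ⊢
    linear_combination -this)
  exact isUnit_of_mul_isUnit_left (h3 ▸ Ideal.mem_jacobson_bot.1 h2 _)

theorem isLocalRing
    (hV : IsCoeffRing (IsLocalRing.maximalIdeal R) p V) (hp : (p : R) ∈ IsLocalRing.maximalIdeal R) :
    IsLocalRing V := by
  refine IsLocalRing.of_isUnit_or_isUnit_one_sub_self fun a => ?_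
  by_cases h : (a : R) ∈ IsLocalRing.maximalIdeal R
  · exact Or.inr (hV.isUnit_of_notMem hp fun h1 => (Ideal.ne_top_iff_one _).1
      (IsLocalRing.maximalIdeal.isMaximal R).ne_top (by simpa using add_mem h1 h))
  · exact Or.inl (hV.isUnit_of_notMem hp h)

theorem maximalIdeal_eq [IsLocalRing V]
    (hV : IsCoeffRing (IsLocalRing.maximalIdeal R) p V) (hp : (p : R) ∈ IsLocalRing.maximalIdeal R) :
    IsLocalRing.maximalIdeal V = Ideal.span {(p : V)} := by
  ext v
  have h : v ∈ IsLocalRing.maximalIdeal V ↔ (v : R) ∈ IsLocalRing.maximalIdeal R :=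
    ⟨fun h => by
      by_contra h1
      exact (IsLocalRing.mem_maximalIdeal v).1 h (hV.isUnit_of_notMem hp h1),
    fun h h1 => (IsLocalRing.mem_maximalIdeal _).1 h (h1.map V.subtype)⟩
  rw [h]
  constructor
  · intro hv
    rw [← pow_one (Ideal.span _), mem_span_natCast_pow, pow_one]
    exact hV.exists_eq_mul_of_mem hp v.2 hv
  · intro hv
    rw [← pow_one (Ideal.span _), mem_span_natCast_pow, pow_one] at hv
    obtain ⟨u, -, h⟩ := hv
    rw [h]
    exact Ideal.mul_mem_right _ _ hp

end IsCoeffRing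

end CoefficientRing

/-- In a local ring with principal maximal ideal `(t)`, separated for the `t`-adic topology, each
nonzero ideal is generated by a power of `t`. -/
theorem Ideal.eq_bot_or_eq_span_pow {V : Type*} [CommRing V] [IsLocalRing V] {t : V}
    (ht : IsLocalRing.maximalIdeal V = Ideal.span {t}) [IsHausdorff (Ideal.span {t}) V]
    (I : Ideal V) : I = ⊥ ∨ ∃ j, I = Ideal.span {t ^ j} := by
  classical
  have hv (v : V) (hv : v ≠ 0) : ∃ j, ∃ u : Vˣ, v = t ^ j * u := by
    obtain ⟨n, hn⟩ := not_forall.1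
      (mt (CoefficientRing.eq_zero_of_forall_mem_pow (m := Ideal.span {t})) hv)
    rw [Ideal.span_singleton_pow, Ideal.mem_span_singleton] at hn
    have h : ∃ n, ¬ t ^ n ∣ v := ⟨n, hn⟩
    have h0 : Nat.find h ≠ 0 := fun h0 => Nat.find_spec h (by rw [h0, pow_zero]; exact one_dvd v)
    obtain ⟨u, hu⟩ := not_not.1 (Nat.find_min h (Nat.sub_one_lt h0))
    have hu' : u ∉ IsLocalRing.maximalIdeal V := fun hu' => by
      rw [ht, Ideal.mem_span_singleton] at hu'
      obtain ⟨w, rfl⟩ := hu'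
      refine Nat.find_spec h ⟨w, ?_⟩
      refine hu.trans ?_
      rw [← mul_assoc, ← pow_succ, Nat.sub_add_cancel (Nat.one_le_iff_ne_zero.2 h0)]
    obtain ⟨u, rfl⟩ := IsLocalRing.notMem_maximalIdeal.1 hu'
    exact ⟨_, u, hu⟩
  have hmem {v : V} {j : ℕ} {u : Vˣ} (h : v = t ^ j * u) (hvI : v ∈ I) : t ^ j ∈ I := by
    rw [show t ^ j = v * ↑u⁻¹ by rw [h, mul_assoc, Units.mul_inv, mul_one]]
    exact I.mul_mem_right _ hvI
  by_cases hI : I = ⊥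
  · exact Or.inl hI
  right
  obtain ⟨x, hxI, hx0⟩ := Submodule.exists_mem_ne_zero_of_ne_bot hI
  obtain ⟨j, u, hx⟩ := hv x hx0
  have h : ∃ j, t ^ j ∈ I := ⟨j, hmem hx hxI⟩
  refine ⟨Nat.find h, le_antisymm (fun y hy => ?_) ?_⟩
  · by_cases hy0 : y = 0
    · rw [hy0]; exact zero_mem _
    obtain ⟨i, u, hyi⟩ := hv y hy0
    have h1 : Nat.find h ≤ i := Nat.find_min' h (hmem hyi hy)
    rw [hyi]
    exact Ideal.mul_mem_right _ _ (Ideal.mem_span_singleton.2 (pow_dvd_pow t h1))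
  · rw [Ideal.span_singleton_le_iff_mem]
    exact Nat.find_spec h

end

noncomputable section

/-! ### Power series over complete local rings -/

namespace PowerSeries

open IsLocalRing

theorem coeff_mem_of_mem_pow {A : Type*} [CommRing A] [IsLocalRing A] {n : ℕ} {f : A⟦X⟧}
    (hf : f ∈ maximalIdeal A⟦X⟧ ^ n) (i : ℕ) : coeff i f ∈ maximalIdeal A ^ (n - i) := by
  let K (n : ℕ) : Ideal A⟦X⟧ :=
    { carrier := {f | ∀ i, coeff i f ∈ maximalIdeal A ^ (n - i)}
      add_mem' := fun {f g} hf hg i => by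
        rw [map_add]
        exact add_mem (hf i) (hg i)
      zero_mem' := fun i => by
        rw [map_zero]
        exact zero_mem _
      smul_mem' := fun f g hg i => by
        rw [smul_eq_mul, coeff_mul]
        refine sum_mem fun ab hab => Ideal.mul_mem_left _ _ (Ideal.pow_le_pow_right ?_ (hg _))
        have := Finset.HasAntidiagonal.mem_antidiagonal.1 hab
        omega }
  have key (n : ℕ) : maximalIdeal A⟦X⟧ ^ n ≤ K n := by
    induction n with
    | zero => exact fun f _ i => by simp
    | succ n ih =>
      rw [pow_succ', Ideal.mul_le]
      intro f hf g hg i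
      rw [coeff_mul]
      refine sum_mem fun ab hab => ?_
      have h1 := Finset.HasAntidiagonal.mem_antidiagonal.1 hab
      have h2 := ih hg ab.2
      rcases Nat.eq_zero_or_pos ab.1 with h0 | h0
      · have h3 : coeff ab.1 f ∈ maximalIdeal A := by
          rw [h0, coeff_zero_eq_constantCoeff_apply]
          exact fun h => hf (isUnit_iff_constantCoeff.2 h)
        refine Ideal.pow_le_pow_right (show n + 1 - i ≤ n - ab.2 + 1 by omega) ?_
        rw [pow_succ']
        exact Ideal.mul_mem_mul h3 h2
      · exact Ideal.mul_mem_left _ _ (Ideal.pow_le_pow_right (by omega) h2)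
  exact key n hf i

theorem mem_pow_of_coeff_mem {A : Type*} [CommRing A] [IsLocalRing A] {n : ℕ} {f : A⟦X⟧}
    (hf : ∀ i, coeff i f ∈ maximalIdeal A ^ (n - i)) : f ∈ maximalIdeal A⟦X⟧ ^ n := by
  have hX : (X : A⟦X⟧) ∈ maximalIdeal A⟦X⟧ := fun h => by
    have := isUnit_iff_constantCoeff.1 h
    rw [constantCoeff_X] at this
    exact not_isUnit_zero this
  have hC : (maximalIdeal A).map C ≤ maximalIdeal A⟦X⟧ := by
    refine Ideal.map_le_iff_le_comap.2 fun a ha h => ha ?_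
    have := isUnit_iff_constantCoeff.1 h
    rwa [constantCoeff_C] at this
  let s : A⟦X⟧ := ∑ i ∈ Finset.range n, C (coeff i f) * X ^ i
  have h1 : (X : A⟦X⟧) ^ n ∣ f - s := by
    rw [X_pow_dvd_iff]
    intro i hi
    simp only [s, map_sub, map_sum, coeff_C_mul, coeff_X_pow]
    simp [hi]
  obtain ⟨g, hg⟩ := h1
  rw [sub_eq_iff_eq_add.1 hg]
  refine add_mem (Ideal.mul_mem_right _ _ (Ideal.pow_mem_pow hX n)) (sum_mem fun i hi => ?_)
  have h2 : C (coeff i f) ∈ maximalIdeal A⟦X⟧ ^ (n - i) := by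
    have := Ideal.mem_map_of_mem (C (R := A)) (hf i)
    rw [Ideal.map_pow] at this
    exact Ideal.pow_right_mono hC _ this
  have h3 := Ideal.mul_mem_mul h2 (Ideal.pow_mem_pow hX i)
  rwa [← pow_add, Nat.sub_add_cancel (Finset.mem_range.1 hi).le] at h3

end PowerSeries

namespace LocalDuality

open PowerSeries IsLocalRing

/-- The ring of power series over a complete local ring is a complete local ring. -/
instance {A : Type u} [CommRing A] [IsCompleteLocalRing A] : IsCompleteLocalRing A⟦X⟧ where
  isAdicComplete := by
    have hA : IsAdicComplete (maximalIdeal A) A := IsCompleteLocalRing.isAdicComplete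
    refine { haus' := fun f hf => ?_, prec' := fun f hf => ?_ }
    · ext i
      refine CoefficientRing.eq_zero_of_forall_mem_pow (m := maximalIdeal A) fun n => ?_
      have := hf (n + i)
      rw [SModEq.zero, smul_eq_mul, Ideal.mul_top] at this
      simpa using coeff_mem_of_mem_pow this i
    · have h1 (i n : ℕ) : coeff i (f (n + i)) - coeff i (f (n + 1 + i)) ∈
          maximalIdeal A ^ (n + 0) := by
        have := hf (show n + i ≤ n + 1 + i by omega)
        rw [SModEq.sub_mem, smul_eq_mul, Ideal.mul_top] at this
        simpa using coeff_mem_of_mem_pow this i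
      choose L hL using fun i => CoefficientRing.exists_limit _ 0 (h1 i)
      refine ⟨PowerSeries.mk L, fun n => ?_⟩
      rw [SModEq.sub_mem, smul_eq_mul, Ideal.mul_top]
      refine mem_pow_of_coeff_mem fun i => ?_
      rw [map_sub, coeff_mk]
      rcases Nat.le_total i n with h | h
      · have := hL i (n - i)
        rwa [Nat.sub_add_cancel h, add_zero] at this
      · rw [Nat.sub_eq_zero_of_le h, pow_zero, Ideal.one_eq_top]
        trivial

/-- Evaluation of power series at an element of the maximal ideal of a complete local ring. -/
theorem exists_powerSeries_eval {A R : Type u} [CommRing A] [CommRing R] [IsCompleteLocalRing R]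
    (ψ : A →+* R) {x : R} (hx : x ∈ maximalIdeal R) :
    ∃ Φ : A⟦X⟧ →+* R, Φ.comp C = ψ ∧ Φ X = x := by
  -- the coefficients carry the discrete topology
  let _ : WithIdeal A := ⟨⊥⟩
  let _ : WithIdeal R := ⟨maximalIdeal R⟩
  have hR : IsAdicComplete (maximalIdeal R) R := IsCompleteLocalRing.isAdicComplete
  have hadic : IsAdic (maximalIdeal R) := rfl
  obtain ⟨_, _⟩ := hadic.isAdicComplete_iff.1 hR
  have hψ : Continuous ψ := (WithIdeal.uniformContinuous_of_map_le (f := ψ) (by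
    rw [show (WithIdeal.i : Ideal A) = ⊥ from rfl, Ideal.map_bot]
    exact bot_le)).continuous
  have hxe : PowerSeries.HasEval x := WithIdeal.isTopologicallyNilpotent_of_mem hx
  refine ⟨PowerSeries.eval₂Hom hψ hxe, ?_, ?_⟩
  · ext a
    rw [RingHom.comp_apply, coe_eval₂Hom, eval₂_C]
  · rw [coe_eval₂Hom, eval₂_X]

end LocalDuality

end

noncomputable section

/-! ### Finite injective dimension and regular sequences -/

namespace InjectiveDimension

open Abelian

open scoped Pointwise

variable {S : Type u} [CommRing S]

/-- Baer's criterion for the injective dimension: only the quotients of the ring need be tested. -/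
theorem hasInjectiveDimensionLT_of_forall_quotient (n : ℕ) : ∀ M : ModuleCat.{u} S,
    (∀ I : Ideal S, Subsingleton (Ext.{u} (ModuleCat.of S (S ⧸ I)) M (n + 1))) →
      HasInjectiveDimensionLT M (n + 1) := by
  induction n with
  | zero =>
    intro M h
    rw [← injective_iff_hasInjectiveDimensionLT_one]
    have hB : Module.Baer S M := by
      intro I g
      let X := ShortComplex.mk (ModuleCat.ofHom I.subtype) (ModuleCat.ofHom I.mkQ) (by
        ext y
        exact (Submodule.Quotient.mk_eq_zero I).2 y.2)
      have hX : X.ShortExact := ModuleCat.shortComplex_shortExact _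
        (LinearMap.exact_subtype_mkQ I) I.injective_subtype I.mkQ_surjective
      have := h I
      obtain ⟨g', hg'⟩ := Ext.contravariant_sequence_exact₁ hX M (Ext.mk₀ (ModuleCat.ofHom g))
        (zero_add 1 : 0 + 1 = 1) (Subsingleton.elim (α := Ext X.X₃ M 1) _ _)
      obtain ⟨g', rfl⟩ := (Ext.mk₀_bijective _ _).2 g'
      rw [Ext.mk₀_comp_mk₀] at hg'
      have hg'' := (Ext.mk₀_bijective _ _).1 hg'
      exact ⟨g'.hom, fun x hx => congrArg (fun k => k.hom ⟨x, hx⟩) hg''⟩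
    have := hB.injective
    exact Module.injective_object_of_injective_module S M
  | succ n ih =>
    intro M h
    let X := ShortComplex.mk (Injective.ι M) (Limits.cokernel.π (Injective.ι M))
      (Limits.cokernel.condition _)
    have hX : X.ShortExact :=
      { exact := ShortComplex.exact_of_g_is_cokernel _ (Limits.cokernelIsCokernel _)
        mono_f := inferInstanceAs (Mono (Injective.ι M))
        epi_g := inferInstanceAs (Epi (Limits.cokernel.π _)) }
    have hI : Injective X.X₂ := inferInstanceAs (Injective (Injective.under M))
    refine (hX.hasInjectiveDimensionLT_X₃_iff n hI).1 (ih X.X₃ fun I => ?_)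
    have := h I
    refine subsingleton_of_forall_eq 0 fun x => ?_
    obtain ⟨y, rfl⟩ := Ext.covariant_sequence_exact₃ _ hX x rfl
      (Subsingleton.elim (α := Ext _ X.X₁ (n + 2)) _ _)
    rw [y.eq_zero_of_injective, Ext.zero_comp]

theorem comp_mk₀_smul_id {X Y : ModuleCat.{u} S} {n : ℕ} (z : Ext.{u} X Y n) (x : S) :
    z.comp (Ext.mk₀ (x • 𝟙 Y)) (add_zero n) = x • z := by
  rw [Ext.mk₀_smul, Ext.comp_smul, Ext.comp_mk₀_id]

section Local

variable [IsNoetherianRing S] [IsLocalRing S] {L : Type u} [AddCommGroup L] [Module S L]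

/-- If the quotient of a finite module by a regular element has finite injective dimension, then so
does the module: multiplication by this element is surjective on the `Ext` modules in high degrees,
so that these vanish by Nakayama's lemma. -/
theorem hasInjectiveDimensionLT_of_quotSMulTop [Module.Finite S L] {x : S}
    (hx : x ∈ IsLocalRing.maximalIdeal S) (hxL : IsSMulRegular L x) {n : ℕ}
    (h : HasInjectiveDimensionLT (ModuleCat.of S (QuotSMulTop x L)) n) :
    HasInjectiveDimensionLT (ModuleCat.of S L) (n + 1) := by
  refine hasInjectiveDimensionLT_of_forall_quotient n _ fun I => ?_
  set A := ModuleCat.of S (S ⧸ I)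
  have hX := IsSMulRegular.smulShortComplex_shortExact (M := ModuleCat.of S L) hxL
  have hfin : Module.Finite S (Ext.{u} A (ModuleCat.of S L) (n + 1)) := by
    have : Module.Finite S A := inferInstanceAs (Module.Finite S (S ⧸ I))
    have : Module.Finite S (ModuleCat.of S L) := ‹Module.Finite S L›
    exact ModuleCat.finite_ext S A (ModuleCat.of S L) (n + 1)
  have htop : (⊤ : Submodule S (Ext.{u} A (ModuleCat.of S L) (n + 1))) ≤
      IsLocalRing.maximalIdeal S • ⊤ := by
    intro y _
    have h3 : HasInjectiveDimensionLT ((ModuleCat.of S L).smulShortComplex x).X₃ n := h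
    obtain ⟨z, hz⟩ := Ext.covariant_sequence_exact₂ A hX y
      ((y.comp _ _).eq_zero_of_hasInjectiveDimensionLT n (by omega))
    have h1 : x • z = y := by
      rw [← hz]
      exact (comp_mk₀_smul_id z x).symm
    rw [← h1]
    exact Submodule.smul_mem_smul hx trivial
  have := Submodule.eq_bot_of_le_smul_of_le_jacobson_bot _ _ hfin.fg_top htop
    (IsLocalRing.maximalIdeal_le_jacobson _)
  exact (Submodule.subsingleton_iff S).1 (subsingleton_of_bot_eq_top this.symm)

theorem exists_hasInjectiveDimensionLT_of_isWeaklyRegular (rs : List S) :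
    ∀ (L : Type u) [AddCommGroup L] [Module S L] [Module.Finite S L],
      (∀ r ∈ rs, r ∈ IsLocalRing.maximalIdeal S) → RingTheory.Sequence.IsWeaklyRegular L rs →
      ∀ n, HasInjectiveDimensionLT (ModuleCat.of S (L ⧸ (Ideal.ofList rs • ⊤ : Submodule S L))) n →
      ∃ n', HasInjectiveDimensionLT (ModuleCat.of S L) n' := by
  induction rs with
  | nil =>
    intro L _ _ _ _ _ n h
    have h0 : (Ideal.ofList ([] : List S) • ⊤ : Submodule S L) = ⊥ := by
      rw [Ideal.ofList_nil, Submodule.bot_smul]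
    exact ⟨n, hasInjectiveDimensionLT_of_iso (Submodule.quotEquivOfEqBot _ h0).toModuleIso n⟩
  | cons r rs ih =>
    intro L _ _ _ hm hreg n h
    rw [RingTheory.Sequence.isWeaklyRegular_cons_iff] at hreg
    have := hasInjectiveDimensionLT_of_iso
      (Submodule.quotOfListConsSMulTopEquivQuotSMulTopInner L r rs).toModuleIso n
    obtain ⟨n', h'⟩ := ih (QuotSMulTop r L) (fun a ha => hm a (List.mem_cons_of_mem _ ha)) hreg.2
      n this
    exact ⟨n' + 1, hasInjectiveDimensionLT_of_quotSMulTop (hm r List.mem_cons_self) hreg.1 h'⟩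

end Local

theorem hasInjectiveDimensionLT_hom_quotSMulTop {L I : Type u} [AddCommGroup L] [Module S L]
    [AddCommGroup I] [Module S I] [Module.Injective S I] {x : S} (hxL : IsSMulRegular L x) {n : ℕ}
    (h : HasInjectiveDimensionLT (ModuleCat.of S (L →ₗ[S] I)) n) :
    HasInjectiveDimensionLT (ModuleCat.of S (QuotSMulTop x L →ₗ[S] I)) (n + 1) := by
  have hX := LocalCoh.homComplex_shortExact (I := I)
    (Submodule.mkQ_surjective (x • ⊤ : Submodule S L))
  refine hX.hasInjectiveDimensionLT_X₁ n ?_ (hasInjectiveDimensionLT_of_ge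
    (ModuleCat.of S (L →ₗ[S] I)) n (n + 1) n.le_succ)
  let e : L ≃ₗ[S] LinearMap.ker (Submodule.mkQ (x • ⊤ : Submodule S L)) :=
    LinearEquiv.ofInjective (LinearMap.lsmul S L x) hxL ≪≫ₗ LinearEquiv.ofEq _ _ (by
      rw [Submodule.ker_mkQ]
      ext y
      simp [Submodule.mem_smul_pointwise_iff_exists])
  exact hasInjectiveDimensionLT_of_iso (LinearEquiv.congrLeft I S e).toModuleIso n

theorem exists_hasInjectiveDimensionLT_hom {I : Type u} [AddCommGroup I] [Module S I]
    [Module.Injective S I] (rs : List S) :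
    ∀ (L : Type u) [AddCommGroup L] [Module S L], RingTheory.Sequence.IsWeaklyRegular L rs →
      ∀ n, HasInjectiveDimensionLT (ModuleCat.of S (L →ₗ[S] I)) n →
      ∃ n', HasInjectiveDimensionLT
        (ModuleCat.of S ((L ⧸ (Ideal.ofList rs • ⊤ : Submodule S L)) →ₗ[S] I)) n' := by
  induction rs with
  | nil =>
    intro L _ _ _ n h
    have h0 : (Ideal.ofList ([] : List S) • ⊤ : Submodule S L) = ⊥ := by
      rw [Ideal.ofList_nil, Submodule.bot_smul]
    exact ⟨n, hasInjectiveDimensionLT_of_iso (LinearEquiv.congrLeft I S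
      (Submodule.quotEquivOfEqBot _ h0).symm).toModuleIso n⟩
  | cons r rs ih =>
    intro L _ _ hreg n h
    rw [RingTheory.Sequence.isWeaklyRegular_cons_iff] at hreg
    obtain ⟨n', h'⟩ := ih (QuotSMulTop r L) hreg.2 (n + 1)
      (hasInjectiveDimensionLT_hom_quotSMulTop hreg.1 h)
    exact ⟨n', hasInjectiveDimensionLT_of_iso (LinearEquiv.congrLeft I S
      (Submodule.quotOfListConsSMulTopEquivQuotSMulTopInner L r rs).symm).toModuleIso n'⟩

/-- A Noetherian local ring is Gorenstein if its quotient by a regular sequence is self-injective.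
Such a quotient is a direct summand of its `Hom` into an injective module, which has finite
injective dimension over the ring. -/
theorem exists_hasInjectiveDimensionLT_of_surjective [IsNoetherianRing S] [IsLocalRing S]
    {rs : List S} (hrs : RingTheory.Sequence.IsWeaklyRegular S rs)
    (hm : ∀ r ∈ rs, r ∈ IsLocalRing.maximalIdeal S) {B : Type u} [CommRing B]
    [Module.Injective B B] (χ : S →+* B) (hχ : Function.Surjective χ)
    (hker : RingHom.ker χ = Ideal.ofList rs) :
    ∃ n, HasInjectiveDimensionLT (ModuleCat.of S S) n := by
  have : Injective (ModuleCat.of B B) := Module.injective_object_of_injective_module B B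
  obtain ⟨I, _, _, hI, ⟨r⟩⟩ := LocalCoh.exists_retract_hom χ (ModuleCat.of B B)
  have : Injective (ModuleCat.of S I) := Module.injective_object_of_injective_module S I
  have h0 : HasInjectiveDimensionLT (ModuleCat.of S (S →ₗ[S] I)) 1 :=
    hasInjectiveDimensionLT_of_iso (LinearMap.ringLmapEquivSelf S S I).symm.toModuleIso 1
  obtain ⟨n, hn⟩ := exists_hasInjectiveDimensionLT_hom rs S hrs 1 h0
  let e : (S ⧸ (Ideal.ofList rs • ⊤ : Submodule S S)) ≃ₗ[S]
      (ModuleCat.restrictScalars χ).obj (ModuleCat.of B B) := by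
    let f : S →ₗ[S] (ModuleCat.restrictScalars χ).obj (ModuleCat.of B B) :=
      { toFun := χ, map_add' := χ.map_add, map_smul' := χ.map_mul }
    exact Submodule.quotEquivOfEq _ (LinearMap.ker f) (by
      rw [Ideal.smul_eq_mul, Ideal.mul_top, ← hker]
      rfl) ≪≫ₗ LinearMap.quotKerEquivOfSurjective f hχ
  have h1 := hasInjectiveDimensionLT_of_iso (LinearEquiv.congrLeft I S e).toModuleIso n
  have h2 := r.hasInjectiveDimensionLT n
  have h3 := hasInjectiveDimensionLT_of_iso e.symm.toModuleIso n
  exact exists_hasInjectiveDimensionLT_of_isWeaklyRegular rs S hm hrs n h3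

end InjectiveDimension

end

noncomputable section

/-! ### Regular sequences and surjective ring homomorphisms -/

namespace RingTheory.Sequence

theorem isWeaklyRegular_quotient_iff_of_surjective {A B : Type*} [CommRing A] [CommRing B]
    {χ : A →+* B} (hχ : Function.Surjective χ) {N : Submodule A A} (hN : N = RingHom.ker χ)
    (ys : List A) : IsWeaklyRegular (A ⧸ N) ys ↔ IsWeaklyRegular B (ys.map χ) := by
  subst hN
  let e : (A ⧸ (RingHom.ker χ : Submodule A A)) ≃+ B :=
    (RingHom.quotientKerEquivOfSurjective hχ).toAddEquiv
  refine AddEquiv.isWeaklyRegular_congr (e := e) (List.forall₂_map_right_iff.mpr <|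
    List.forall₂_same.mpr fun r _ x => ?_)
  obtain ⟨a, rfl⟩ := Submodule.mkQ_surjective _ x
  exact χ.map_mul r a

end RingTheory.Sequence

namespace LocalDuality

open IsLocalRing RingTheory.Sequence

/-! ### A ring of power series over a coefficient ring -/

/-- Adjoining power series variables to `V`: for elements `xs` of the maximal ideal of `R`, the ring
`A = V⟦X₁, …, Xₙ⟧` has a homomorphism to `R` that sends the variables to `xs`, and the variables
form a regular sequence with quotient `V`. -/
theorem exists_regular_lift {V R : Type u} [CommRing V] [CommRing R] [IsCompleteLocalRing V]
    [IsCompleteLocalRing R] (ψ : V →+* R) (xs : List R) (hxs : ∀ x ∈ xs, x ∈ maximalIdeal R) :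
    ∃ (A : Type u) (_ : CommRing A) (_ : IsCompleteLocalRing A) (φ : A →+* R) (ι : V →+* A)
      (χ : A →+* V) (ys : List A), φ.comp ι = ψ ∧ χ.comp ι = RingHom.id V ∧ ys.map φ = xs ∧
      (∀ y ∈ ys, y ∈ maximalIdeal A) ∧ IsWeaklyRegular A ys ∧ RingHom.ker χ = Ideal.ofList ys := by
  induction xs with
  | nil =>
    refine ⟨V, inferInstance, inferInstance, ψ, RingHom.id V, RingHom.id V, [], rfl, rfl, rfl,
      fun _ h => (List.not_mem_nil h).elim, .nil _ _, ?_⟩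
    rw [Ideal.ofList_nil]
    exact (RingHom.injective_iff_ker_eq_bot _).1 Function.injective_id
  | cons x xs ih =>
    obtain ⟨A, _, _, φ, ι, χ, ys, h1, h2, h3, h4, h5, h6⟩ :=
      ih fun y hy => hxs y (List.mem_cons_of_mem _ hy)
    obtain ⟨Φ, hΦ, hX⟩ := exists_powerSeries_eval φ (hxs x List.mem_cons_self)
    have hker : RingHom.ker (PowerSeries.constantCoeff (R := A)) = Ideal.span {PowerSeries.X} := by
      ext f
      rw [RingHom.mem_ker, Ideal.mem_span_singleton, PowerSeries.X_dvd_iff]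
    have hsurj : Function.Surjective (PowerSeries.constantCoeff (R := A)) :=
      fun a => ⟨PowerSeries.C a, PowerSeries.constantCoeff_C a⟩
    refine ⟨PowerSeries A, inferInstance, inferInstance, Φ, PowerSeries.C.comp ι,
      χ.comp PowerSeries.constantCoeff, PowerSeries.X :: ys.map PowerSeries.C, ?_, ?_, ?_, ?_, ?_,
      ?_⟩
    · rw [← RingHom.comp_assoc, hΦ, h1]
    · ext v
      simpa using congrArg (fun f => f v) h2
    · rw [List.map_cons, hX, List.map_map, ← RingHom.coe_comp, hΦ, h3]
    · intro y hy
      rw [mem_maximalIdeal, mem_nonunits_iff, PowerSeries.isUnit_iff_constantCoeff]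
      rcases List.mem_cons.1 hy with rfl | hy
      · rw [PowerSeries.constantCoeff_X]
        exact not_isUnit_zero
      · obtain ⟨a, ha, rfl⟩ := List.mem_map.1 hy
        rw [PowerSeries.constantCoeff_C]
        exact h4 a ha
    · rw [isWeaklyRegular_cons_iff]
      refine ⟨fun f g hfg => PowerSeries.X_mul_cancel hfg, ?_⟩
      refine (isWeaklyRegular_quotient_iff_of_surjective hsurj ?_ _).2 ?_
      · rw [hker, ← Submodule.ideal_span_singleton_smul, smul_eq_mul, Ideal.mul_top]
      · have : (PowerSeries.constantCoeff (R := A)) ∘ PowerSeries.C = id :=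
          funext PowerSeries.constantCoeff_C
        rwa [List.map_map, this, List.map_id]
    · rw [Ideal.ofList_cons, ← hker, ← RingHom.comap_ker, h6, ← Ideal.map_ofList]
      refine le_antisymm (fun f hf => ?_) (sup_le (fun f hf => ?_) (Ideal.map_le_iff_le_comap.2
        fun a ha => ?_))
      · rw [← sub_add_cancel f (PowerSeries.C (PowerSeries.constantCoeff f))]
        refine add_mem (Ideal.mem_sup_left ?_)
          (Ideal.mem_sup_right (Ideal.mem_map_of_mem _ (Ideal.mem_comap.1 hf)))
        rw [RingHom.mem_ker, map_sub, PowerSeries.constantCoeff_C, sub_self]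
      · rw [Ideal.mem_comap, RingHom.mem_ker.1 hf]
        exact zero_mem _
      · rwa [Ideal.mem_comap, Ideal.mem_comap, PowerSeries.constantCoeff_C]

/-! ### Finiteness over a complete local ring -/

theorem isPrecomplete_pi {A : Type*} [CommRing A] (I : Ideal A) [IsPrecomplete I A] (k : ℕ) :
    IsPrecomplete I (Fin k → A) := by
  have hmem (J : Ideal A) (x : Fin k → A) :
      x ∈ (J • ⊤ : Submodule A (Fin k → A)) ↔ ∀ i, x i ∈ J := by
    refine ⟨fun h => ?_, fun h => ?_⟩
    · refine Submodule.smul_induction_on h (fun a ha y _ i => J.mul_mem_right _ ha)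
        fun y z hy hz i => add_mem (hy i) (hz i)
    · rw [pi_eq_sum_univ' x]
      exact sum_mem fun i _ => Submodule.smul_mem_smul (h i) trivial
  refine ⟨fun f hf => ?_⟩
  have h1 (i : Fin k) (n : ℕ) : f n i - f (n + 1) i ∈ I ^ (n + 0) := by
    have := hf n.le_succ
    rw [SModEq.sub_mem, hmem] at this
    exact this i
  choose L hL using fun i => CoefficientRing.exists_limit _ 0 (h1 i)
  refine ⟨L, fun n => ?_⟩
  rw [SModEq.sub_mem, hmem]
  exact fun i => hL i n

/-- A homomorphism of complete local rings is finite if it is surjective on residue fields and its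
fibre is Artinian. -/
theorem finite_of_pow_le_map {A R : Type u} [CommRing A] [CommRing R] [IsCompleteLocalRing A]
    [IsCompleteLocalRing R] {φ : A →+* R} (hφ : ∀ r, ∃ a, r - φ a ∈ maximalIdeal R)
    (hm : (maximalIdeal A).map φ ≤ maximalIdeal R) {e : ℕ}
    (he : maximalIdeal R ^ e ≤ (maximalIdeal A).map φ) : φ.Finite := by
  algebraize [φ]
  have hA : IsAdicComplete (maximalIdeal A) A := IsCompleteLocalRing.isAdicComplete
  have hR : IsAdicComplete (maximalIdeal R) R := IsCompleteLocalRing.isAdicComplete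
  have key (i : ℕ) : ∃ s : Finset R, ∀ r, ∃ y ∈ Submodule.span A (s : Set R),
      r - y ∈ maximalIdeal R ^ i := by
    classical
    induction i with
    | zero => exact ⟨∅, fun r => ⟨0, zero_mem _, by simp⟩⟩
    | succ i ih =>
      obtain ⟨s, hs⟩ := ih
      obtain ⟨g, hg⟩ := (maximalIdeal R ^ i).fg_of_isNoetherianRing
      refine ⟨s ∪ g, fun r => ?_⟩
      obtain ⟨y, hy, hry⟩ := hs r
      have h1 : ∀ z ∈ maximalIdeal R ^ i, ∃ w ∈ Submodule.span A (g : Set R),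
          z - w ∈ maximalIdeal R ^ (i + 1) := by
        intro z hz
        rw [← hg] at hz
        induction hz using Submodule.span_induction with
        | mem z hz => exact ⟨z, Submodule.subset_span hz, by rw [sub_self]; exact zero_mem _⟩
        | zero => exact ⟨0, zero_mem _, by rw [sub_self]; exact zero_mem _⟩
        | add z z' _ _ h h' =>
          obtain ⟨w, hw, h⟩ := h
          obtain ⟨w', hw', h'⟩ := h'
          exact ⟨w + w', add_mem hw hw', by rw [add_sub_add_comm]; exact add_mem h h'⟩
        | smul c z hz h =>
          obtain ⟨w, hw, h⟩ := h
          obtain ⟨a, ha⟩ := hφ c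
          refine ⟨a • w, Submodule.smul_mem _ _ hw, ?_⟩
          have h2 : z ∈ maximalIdeal R ^ i := by
            rw [← hg]
            exact hz
          have : c • z - a • w = (c - φ a) * z + φ a * (z - w) := by
            change c * z - φ a * w = _
            ring
          rw [this]
          refine add_mem ?_ (Ideal.mul_mem_left _ _ h)
          rw [pow_succ']
          exact Ideal.mul_mem_mul ha h2
      obtain ⟨w, hw, h2⟩ := h1 _ hry
      refine ⟨y + w, add_mem (Submodule.span_mono (by simp) hy) (Submodule.span_mono (by simp) hw),
        ?_⟩
      rwa [← sub_sub]
  obtain ⟨s, hs⟩ := key e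
  have hpow (n : ℕ) {x : R} (hx : x ∈ (maximalIdeal A ^ n • ⊤ : Submodule A R)) :
      x ∈ maximalIdeal R ^ n := by
    rw [Ideal.smul_top_eq_map, Submodule.restrictScalars_mem] at hx
    rw [Ideal.map_pow] at hx
    exact Ideal.pow_right_mono hm n hx
  have : IsHausdorff (maximalIdeal A) R := ⟨fun x hx =>
    CoefficientRing.eq_zero_of_forall_mem_pow (m := maximalIdeal R) fun n =>
      hpow n (SModEq.zero.1 (hx n))⟩
  have := isPrecomplete_pi (maximalIdeal A) s.card
  let f : (Fin s.card → A) →ₗ[A] R := Fintype.linearCombination A fun i => (s.equivFin.symm i : R)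
  have hf : LinearMap.range f = Submodule.span A (s : Set R) := by
    rw [Fintype.range_linearCombination]
    congr 1
    rw [← Function.comp_def, EquivLike.range_comp, Subtype.range_coe]
  have : Function.Surjective f := by
    refine surjective_of_mkQ_comp_surjective (I := maximalIdeal A) fun y => ?_
    obtain ⟨r, rfl⟩ := Submodule.mkQ_surjective _ y
    obtain ⟨y, hy, hry⟩ := hs r
    rw [← hf] at hy
    obtain ⟨v, rfl⟩ := hy
    refine ⟨v, Eq.symm ?_⟩
    rw [LinearMap.comp_apply, ← sub_eq_zero, ← map_sub, Submodule.mkQ_apply,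
      Submodule.Quotient.mk_eq_zero, Ideal.smul_top_eq_map]
    exact he hry
  exact RingHom.finite_algebraMap.2 (Module.Finite.of_surjective f this)

theorem isCompleteLocalRing_quotient {A : Type u} [CommRing A] [IsCompleteLocalRing A]
    {I : Ideal A} (hI : I ≠ ⊤) : IsCompleteLocalRing (A ⧸ I) := by
  have : Nontrivial (A ⧸ I) := Ideal.Quotient.nontrivial_iff.2 hI
  have hA : IsAdicComplete (maximalIdeal A) A := IsCompleteLocalRing.isAdicComplete
  have hloc : IsLocalRing (A ⧸ I) :=
    IsLocalRing.of_surjective' (Ideal.Quotient.mk I) Ideal.Quotient.mk_surjective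
  have hmap : maximalIdeal (A ⧸ I) = (maximalIdeal A).map (Ideal.Quotient.mk I) :=
    (IsLocalRing.map_maximalIdeal_of_surjective _ Ideal.Quotient.mk_surjective).symm
  have hpow (n : ℕ) (a : A) (ha : Ideal.Quotient.mk I a ∈ maximalIdeal (A ⧸ I) ^ n) :
      ∃ b ∈ maximalIdeal A ^ n, Ideal.Quotient.mk I b = Ideal.Quotient.mk I a := by
    rw [hmap, ← Ideal.map_pow] at ha
    exact (Ideal.mem_map_iff_of_surjective _ Ideal.Quotient.mk_surjective).1 ha
  refine { isAdicComplete := { prec' := fun f hf => ?_ } }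
  have hf' (n : ℕ) : f n - f (n + 1) ∈ maximalIdeal (A ⧸ I) ^ n := by
    have := hf n.le_succ
    rwa [SModEq.sub_mem, smul_eq_mul, Ideal.mul_top] at this
  have hstep (n : ℕ) (a : {a : A // Ideal.Quotient.mk I a = f n}) :
      ∃ b : {b : A // Ideal.Quotient.mk I b = f (n + 1)}, a.1 - b.1 ∈ maximalIdeal A ^ n := by
    obtain ⟨c, hc⟩ := Ideal.Quotient.mk_surjective (f (n + 1))
    obtain ⟨b, hb, h⟩ := hpow n (a - c) (by rw [map_sub, a.2, hc]; exact hf' n)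
    refine ⟨⟨a - b, ?_⟩, by rwa [sub_sub_cancel]⟩
    rw [map_sub, h, map_sub, sub_sub_cancel, hc]
  choose next hnext using hstep
  obtain ⟨a₀, ha₀⟩ := Ideal.Quotient.mk_surjective (f 0)
  let g (n : ℕ) : {a : A // Ideal.Quotient.mk I a = f n} := Nat.rec ⟨a₀, ha₀⟩ next n
  obtain ⟨L, hL⟩ := CoefficientRing.exists_limit (m := maximalIdeal A) (fun n => (g n).1) 0
    fun n => hnext n (g n)
  refine ⟨Ideal.Quotient.mk I L, fun n => ?_⟩
  rw [SModEq.sub_mem, smul_eq_mul, Ideal.mul_top, ← (g n).2, ← map_sub, hmap, ← Ideal.map_pow]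
  exact Ideal.mem_map_of_mem _ (hL n)

end LocalDuality

end

noncomputable section

/-! ### Local rings with principal maximal ideal -/

/-- An Artinian local ring with principal maximal ideal is injective over itself. -/
theorem Module.injective_self_of_maximalIdeal_eq_span {B : Type u} [CommRing B] [IsLocalRing B]
    {t : B} (ht : IsLocalRing.maximalIdeal B = Ideal.span {t}) (hnil : IsNilpotent t) :
    Module.Injective B B := by
  classical
  set M := Nat.find hnil
  have hM : t ^ M = 0 := Nat.find_spec hnil
  have hmin {k : ℕ} (hk : t ^ k = 0) : M ≤ k := Nat.find_min' hnil hk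
  have : IsHausdorff (Ideal.span {t}) B := ⟨fun x hx => by
    have := hx M
    rwa [SModEq.zero, Ideal.span_singleton_pow, hM, Ideal.span_singleton_zero, Submodule.bot_smul,
      Submodule.mem_bot] at this⟩
  refine Module.Baer.injective fun I g => ?_
  rcases Ideal.eq_bot_or_eq_span_pow ht I with rfl | ⟨j, rfl⟩
  · refine ⟨0, fun x hx => ?_⟩
    obtain rfl : x = 0 := hx
    rw [LinearMap.zero_apply]
    exact (map_zero g).symm
  have hmem : t ^ j ∈ Ideal.span {t ^ j} := Ideal.mem_span_singleton_self _
  -- `t ^ j` divides its image, so that the map is a multiplication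
  have hdvd : t ^ j ∣ g ⟨t ^ j, hmem⟩ := by
    rcases Ideal.eq_bot_or_eq_span_pow ht (Ideal.span {g ⟨t ^ j, hmem⟩}) with h | ⟨k, h⟩
    · rw [Ideal.span_singleton_eq_bot.1 h]
      exact dvd_zero _
    · have h1 : t ^ (M - j) * g ⟨t ^ j, hmem⟩ = 0 := by
        rw [← smul_eq_mul, ← map_smul]
        convert map_zero g
        refine Subtype.ext ?_
        change t ^ (M - j) * t ^ j = 0
        rw [← pow_add]
        exact pow_eq_zero_of_le (by omega) hM
      obtain ⟨c, hc⟩ := Ideal.mem_span_singleton.1 (h ▸ Ideal.mem_span_singleton_self (t ^ k))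
      have h2 : t ^ (M - j + k) = 0 := by rw [pow_add, hc, ← mul_assoc, h1, zero_mul]
      have h3 := hmin h2
      -- if `j > M` then `M - j` is truncated, but then the ideal is zero
      rcases Nat.lt_or_ge M j with h4 | h4
      · have : (⟨t ^ j, hmem⟩ : Ideal.span {t ^ j}) = 0 :=
          Subtype.ext (pow_eq_zero_of_le h4.le hM)
        rw [this, map_zero]
        exact dvd_zero _
      · exact (pow_dvd_pow t (show j ≤ k by omega)).trans
          (Ideal.mem_span_singleton.1 (h ▸ Ideal.mem_span_singleton_self _))
  obtain ⟨c, hc⟩ := hdvd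
  refine ⟨LinearMap.mulRight B c, fun x hx => ?_⟩
  obtain ⟨d, rfl⟩ := Ideal.mem_span_singleton.1 hx
  have : (⟨t ^ j * d, hx⟩ : Ideal.span {t ^ j}) = d • ⟨t ^ j, hmem⟩ :=
    Subtype.ext (mul_comm _ _)
  rw [this, map_smul, hc, LinearMap.mulRight_apply, smul_eq_mul]
  ring

/-- In a separated local ring with principal maximal ideal `(t)`, each nonzero ideal is generated by a
power of `t`, so that `t` is nilpotent or a nonzerodivisor. -/
theorem isSMulRegular_of_maximalIdeal_eq_span {V : Type*} [CommRing V] [IsLocalRing V] {t : V}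
    (ht : IsLocalRing.maximalIdeal V = Ideal.span {t}) [IsHausdorff (Ideal.span {t}) V]
    (hnil : ¬ IsNilpotent t) : IsSMulRegular V t := by
  refine isSMulRegular_iff_right_eq_zero_of_smul.2 fun a ha => ?_
  rcases Ideal.eq_bot_or_eq_span_pow ht (Ideal.span {a}) with h | ⟨j, h⟩
  · exact Ideal.span_singleton_eq_bot.1 h
  · obtain ⟨c, hc⟩ := Ideal.mem_span_singleton.1 (h ▸ Ideal.mem_span_singleton_self (t ^ j))
    refine (hnil ⟨j + 1, ?_⟩).elim
    rw [pow_succ', hc, ← mul_assoc, ← smul_eq_mul t a, ha, zero_mul]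

namespace LocalDuality

open IsLocalRing RingTheory.Sequence

/-! ### A Gorenstein ring over which a complete local ring is finite -/

/-- A Noetherian local ring with a regular sequence whose quotient is an Artinian local ring with
principal maximal ideal is Gorenstein, and the sequence is a system of parameters. -/
theorem isGorensteinLocal_of_surjective {S B : Type u} [CommRing S] [IsNoetherianRing S]
    [IsLocalRing S] [CommRing B] [IsLocalRing B] {t : B} (ht : maximalIdeal B = Ideal.span {t})
    (hnil : IsNilpotent t) {xs : List S} (hxs : IsWeaklyRegular S xs)
    (hm : ∀ x ∈ xs, x ∈ maximalIdeal S) {χ : S →+* B} (hχ : Function.Surjective χ)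
    (hker : RingHom.ker χ = Ideal.ofList xs) :
    IsGorensteinLocal S ∧ IsRegular S xs ∧ (xs.length : WithBot ℕ∞) = ringKrullDim S := by
  have := Module.injective_self_of_maximalIdeal_eq_span ht hnil
  obtain ⟨n, hn⟩ := InjectiveDimension.exists_hasInjectiveDimensionLT_of_surjective hxs hm χ hχ hker
  have hreg : IsRegular S xs := .of_isWeaklyRegular_of_mem_maximalIdeal S hm hxs
  refine ⟨⟨inferInstance, inferInstance, n, hasInjectiveDimensionLT_of_ge _ n (n + 1) n.le_succ⟩,
    hreg, ?_⟩
  have hB : Ring.KrullDimLE 0 B := .mk₀ fun P hP => by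
    have : maximalIdeal B ≤ P := by
      rw [ht, Ideal.span_singleton_le_iff_mem]
      obtain ⟨k, hk⟩ := hnil
      exact hP.mem_of_pow_mem k (hk ▸ zero_mem P)
    rw [← (maximalIdeal.isMaximal B).eq_of_le hP.ne_top this]
    infer_instance
  rw [← ringKrullDim_add_length_eq_ringKrullDim_of_isRegular xs hreg, ← hker,
    ringKrullDim_eq_of_ringEquiv (RingHom.quotientKerEquivOfSurjective hχ),
    ringKrullDimZero_iff_ringKrullDim_eq_zero.1 hB, zero_add]

theorem exists_system_of_parameters (R : Type u) [CommRing R] [IsNoetherianRing R]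
    [IsLocalRing R] : ∃ xs : List R, (∀ x ∈ xs, x ∈ maximalIdeal R) ∧
      (xs.length : WithBot ℕ∞) = ringKrullDim R ∧ ∃ e, maximalIdeal R ^ e ≤ Ideal.ofList xs := by
  obtain ⟨s, hs, hcard⟩ := (maximalIdeal R).exists_finset_card_eq_height_of_isNoetherianRing
  have hs' : Ideal.ofList s.toList = Ideal.span (s : Set R) := by
    simp [Ideal.ofList]
  refine ⟨s.toList, fun x hx => ?_, ?_, ?_⟩
  · exact hs.1.2 (Ideal.subset_span (Finset.mem_toList.1 hx))
  · rw [Finset.length_toList, ← maximalIdeal_height_eq_ringKrullDim, ← hcard]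
    rfl
  · rw [hs']
    have hrad : (Ideal.span (s : Set R)).radical = maximalIdeal R := by
      refine le_antisymm (hs.1.1.radical_le_iff.2 hs.1.2) ?_
      rw [Ideal.radical_eq_sInf]
      refine le_sInf fun P hP => ?_
      have : P.IsPrime := hP.2
      exact hs.2 ⟨hP.2, hP.1⟩ (le_maximalIdeal hP.2.ne_top)
    obtain ⟨e, he⟩ := (Ideal.span (s : Set R)).exists_radical_pow_le_of_fg
      ((isNoetherianRing_iff_ideal_fg R).1 inferInstance _)
    exact ⟨e, hrad ▸ he⟩

/-- By the Cayley–Hamilton theorem, a power of `τ` satisfies on `R` a monic equation whose lower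
coefficients lie in `ker χ`; its value at this power of `τ` kills `R` and is a power of `χ τ`
modulo `ker χ`. -/
theorem exists_mem_ker_of_pow_mem {A V R : Type u} [CommRing A] [CommRing V] [CommRing R]
    {φ : A →+* R} (hφ : φ.Finite) (χ : A →+* V) (τ : A) {e : ℕ}
    (he : φ τ ^ e ∈ (RingHom.ker χ).map φ) : ∃ f ∈ RingHom.ker φ, ∃ M, χ f = χ τ ^ M := by
  algebraize [φ]
  have : Module.Finite A R := hφ
  obtain ⟨P, hmonic, -, hcoeff, hP⟩ :=
    LinearMap.exists_monic_and_natDegree_eq_and_coeff_mem_pow_and_aeval_eq_zero A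
      (algebraMap A (Module.End A R) (τ ^ e)) (RingHom.ker χ) (by
        rintro _ ⟨r, rfl⟩
        rw [Module.algebraMap_end_apply, Ideal.smul_top_eq_map, Submodule.restrictScalars_mem,
          Algebra.smul_def, map_pow]
        exact Ideal.mul_mem_right _ _ he)
  refine ⟨P.eval (τ ^ e), ?_, e * P.natDegree, ?_⟩
  · rw [Polynomial.aeval_algebraMap_apply_eq_algebraMap_eval] at hP
    have := congrArg (fun g : Module.End A R => g 1) hP
    rwa [Module.algebraMap_end_apply, Algebra.smul_def, mul_one] at this
  · rw [Polynomial.eval_eq_sum_range, map_sum, Finset.sum_range_succ, hmonic.coeff_natDegree,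
      Finset.sum_eq_zero, zero_add, one_mul, map_pow, map_pow, pow_mul]
    intro k hk
    have h1 : P.coeff k ∈ RingHom.ker χ :=
      Ideal.pow_le_self (Nat.sub_ne_zero_of_lt (Finset.mem_range.1 hk)) (hcoeff k)
    rw [map_mul, RingHom.mem_ker.1 h1, zero_mul]

/-- A complete local ring `R` is finite over the power series ring `A = V⟦X₁, …, X_d⟧`, where
`d = dim R` and the variables go to a system of parameters. If the maximal ideal of `V` is nilpotent
then `A` is the Gorenstein ring sought; otherwise `A` has dimension `d + 1`, and it is replaced by a
hypersurface `A ⧸ (f)` with `f` in the kernel. -/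
theorem exists_finite_isGorensteinLocal_of_ringHom {V R : Type u} [CommRing V] [IsCompleteLocalRing V]
    [CommRing R] [IsCompleteLocalRing R] (ψ : V →+* R) {t : V}
    (ht : maximalIdeal V = Ideal.span {t}) (hψt : ψ t ∈ maximalIdeal R)
    (hψ : ∀ r, ∃ v, r - ψ v ∈ maximalIdeal R) :
    ∃ (S : Type u) (_ : CommRing S) (_ : IsCompleteLocalRing S) (φ : S →+* R),
      IsGorensteinLocal S ∧ IsCohenMacaulayLocal S ∧ φ.Finite ∧ ringKrullDim S = ringKrullDim R := by
  obtain ⟨xs, hxs, hlen, e, he⟩ := exists_system_of_parameters R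
  obtain ⟨A, _, _, φ, ι, χ, ys, hι, hχι, hys, hym, hyreg, hker⟩ := exists_regular_lift ψ xs hxs
  have hlen' : (ys.length : WithBot ℕ∞) = ringKrullDim R := by
    rw [← hlen, ← hys, List.length_map]
  have hι' (v : V) : χ (ι v) = v := congrArg (fun f : V →+* V => f v) hχι
  have hχ : Function.Surjective χ := fun v => ⟨ι v, hι' v⟩
  have hmap : (Ideal.ofList ys).map φ = Ideal.ofList xs := by rw [Ideal.map_ofList, hys]
  have hyA : Ideal.ofList ys ≤ maximalIdeal A := Ideal.span_le.2 hym
  have hVt : IsHausdorff (Ideal.span {t}) V := ht ▸ IsCompleteLocalRing.isAdicComplete.toIsHausdorff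
  have hmA : (maximalIdeal A).map φ ≤ maximalIdeal R := by
    refine Ideal.map_le_iff_le_comap.2 fun a ha => ?_
    have h1 : χ a ∈ maximalIdeal V := by
      have : IsLocalHom χ := IsLocalHom.of_surjective χ hχ
      exact fun h => ha (isUnit_of_map_unit χ a h)
    obtain ⟨v, hv⟩ := Ideal.mem_span_singleton.1 (ht ▸ h1)
    have h2 : a - ι (χ a) ∈ RingHom.ker χ := by
      rw [RingHom.mem_ker, map_sub, hι', sub_self]
    rw [hker] at h2
    have h3 := Ideal.mem_map_of_mem φ h2
    rw [hmap, map_sub, hv, map_mul, map_mul, ← RingHom.comp_apply φ ι t, hι] at h3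
    rw [Ideal.mem_comap, ← sub_add_cancel (φ a) (ψ t * φ (ι v))]
    exact add_mem (Ideal.span_le.2 hxs h3) (Ideal.mul_mem_right _ _ hψt)
  have hfin : φ.Finite := by
    refine finite_of_pow_le_map (fun r => ?_) hmA (he.trans (hmap ▸ Ideal.map_mono hyA))
    obtain ⟨v, hv⟩ := hψ r
    exact ⟨ι v, by rwa [← RingHom.comp_apply, hι]⟩
  by_cases hnil : IsNilpotent t
  · obtain ⟨h1, h2, h3⟩ := isGorensteinLocal_of_surjective ht hnil hyreg hym hχ hker
    exact ⟨A, inferInstance, inferInstance, φ, h1, ⟨inferInstance, inferInstance, ys, h2, h3⟩, hfin,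
      h3.symm.trans hlen'⟩
  obtain ⟨f, hfφ, M, hfM⟩ := exists_mem_ker_of_pow_mem hfin χ (ι t) (e := e) (by
    rw [hker, hmap, ← RingHom.comp_apply, hι]
    exact he (Ideal.pow_mem_pow hψt e))
  rw [hι'] at hfM
  have hfm : f ∈ maximalIdeal A := fun h => not_isUnit_zero (RingHom.mem_ker.1 hfφ ▸ h.map φ)
  have hspan : Ideal.span {f} ≤ maximalIdeal A := (Ideal.span_singleton_le_iff_mem _).2 hfm
  have hS : IsCompleteLocalRing (A ⧸ Ideal.span {f}) :=
    isCompleteLocalRing_quotient fun h => (maximalIdeal.isMaximal A).ne_top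
      (top_le_iff.1 (h ▸ hspan))
  -- `ys` followed by `f` is a regular sequence, which can be permuted
  have hperm : IsWeaklyRegular A (f :: ys) := by
    refine isWeaklyRegular_of_perm_of_subset_maximalIdeal (rs := ys ++ [f]) ?_
      (List.perm_append_singleton _ _) ?_
    · refine (isWeaklyRegular_append_iff A ys [f]).2 ⟨hyreg, ?_⟩
      refine (isWeaklyRegular_quotient_iff_of_surjective hχ ?_ _).2 ?_
      · rw [hker, smul_eq_mul, Ideal.mul_top]
      · rw [List.map_singleton, isWeaklyRegular_singleton_iff, hfM]
        exact (isSMulRegular_of_maximalIdeal_eq_span ht hnil).pow M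
    · intro y hy
      rcases List.mem_append.1 hy with hy | hy
      · exact hym y hy
      · rwa [List.mem_singleton.1 hy]
  have hSreg : IsWeaklyRegular (A ⧸ Ideal.span {f}) (ys.map (Ideal.Quotient.mk (Ideal.span {f}))) :=
    (isWeaklyRegular_quotient_iff_of_surjective Ideal.Quotient.mk_surjective (by
      rw [Ideal.mk_ker, ← Submodule.ideal_span_singleton_smul, smul_eq_mul, Ideal.mul_top]) ys).1
      ((isWeaklyRegular_cons_iff A f ys).1 hperm).2
  have hSm : ∀ y ∈ ys.map (Ideal.Quotient.mk (Ideal.span {f})),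
      y ∈ maximalIdeal (A ⧸ Ideal.span {f}) := by
    intro y hy
    obtain ⟨a, ha, rfl⟩ := List.mem_map.1 hy
    have : IsLocalHom (Ideal.Quotient.mk (Ideal.span {f})) :=
      IsLocalHom.of_surjective _ Ideal.Quotient.mk_surjective
    exact fun h => hym a ha (isUnit_of_map_unit _ a h)
  have htM : t ^ M ∈ maximalIdeal V := by
    have : IsLocalHom χ := IsLocalHom.of_surjective χ hχ
    exact hfM ▸ fun h => hfm (isUnit_of_map_unit χ f h)
  let q := Ideal.Quotient.mk (Ideal.span {t ^ M})
  have hq : Function.Surjective q := Ideal.Quotient.mk_surjective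
  have : IsCompleteLocalRing (V ⧸ Ideal.span {t ^ M}) :=
    isCompleteLocalRing_quotient fun h => (maximalIdeal.isMaximal V).ne_top
      (top_le_iff.1 (h ▸ (Ideal.span_singleton_le_iff_mem _).2 htM))
  have hqt : maximalIdeal (V ⧸ Ideal.span {t ^ M}) = Ideal.span {q t} := by
    rw [← map_maximalIdeal_of_surjective q hq, ht, Ideal.map_span, Set.image_singleton]
  have hqM : IsNilpotent (q t) := ⟨M, by
    rw [← map_pow]
    exact Ideal.Quotient.eq_zero_iff_mem.2 (Ideal.mem_span_singleton_self _)⟩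
  let χ' : A ⧸ Ideal.span {f} →+* V ⧸ Ideal.span {t ^ M} :=
    Ideal.Quotient.lift (Ideal.span {f}) (q.comp χ) fun a ha => by
      obtain ⟨b, rfl⟩ := Ideal.mem_span_singleton.1 ha
      rw [RingHom.comp_apply, map_mul, hfM]
      exact Ideal.Quotient.eq_zero_iff_mem.2
        (Ideal.mul_mem_right _ _ (Ideal.mem_span_singleton_self _))
  have hχ' : Function.Surjective χ' :=
    Ideal.Quotient.lift_surjective_of_surjective _ _ (hq.comp hχ)
  have hker' : RingHom.ker χ' = Ideal.ofList (ys.map (Ideal.Quotient.mk (Ideal.span {f}))) := by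
    rw [← Ideal.map_ofList, ← hker]
    ext x
    obtain ⟨a, rfl⟩ := Ideal.Quotient.mk_surjective x
    rw [Ideal.mem_map_iff_of_surjective _ Ideal.Quotient.mk_surjective, RingHom.mem_ker]
    constructor
    · intro h
      obtain ⟨v, hv⟩ := Ideal.mem_span_singleton.1 (Ideal.Quotient.eq_zero_iff_mem.1 h)
      refine ⟨a - f * ι v, ?_, ?_⟩
      · rw [RingHom.mem_ker, map_sub, map_mul, hι', hv, hfM, sub_self]
      · rw [map_sub, sub_eq_self]
        exact Ideal.Quotient.eq_zero_iff_mem.2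
          (Ideal.mul_mem_right _ _ (Ideal.mem_span_singleton_self _))
    · rintro ⟨b, hb, h⟩
      rw [← h]
      change q (χ b) = 0
      rw [RingHom.mem_ker.1 hb, map_zero]
  obtain ⟨h1, h2, h3⟩ := isGorensteinLocal_of_surjective hqt hqM hSreg hSm hχ' hker'
  refine ⟨A ⧸ Ideal.span {f}, inferInstance, hS, Ideal.Quotient.lift (Ideal.span {f}) φ
    fun a ha => RingHom.mem_ker.1 ((Ideal.span_singleton_le_iff_mem _).2 hfφ ha), h1,
    ⟨inferInstance, inferInstance, _, h2, h3⟩, ?_, ?_⟩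
  · exact RingHom.Finite.of_comp_finite (f := Ideal.Quotient.mk (Ideal.span {f})) (by
      rwa [Ideal.Quotient.lift_comp_mk])
  · rw [← h3, List.length_map, hlen']

theorem exists_finite_gorenstein (R : Type u) [CommRing R] [IsCompleteLocalRing R] :
    ∃ (S : Type u) (_ : CommRing S) (_ : IsCompleteLocalRing S) (φ : S →+* R),
      IsGorensteinLocal S ∧ IsCohenMacaulayLocal S ∧ φ.Finite ∧ ringKrullDim S = ringKrullDim R := by
  have hR : IsAdicComplete (maximalIdeal R) R := IsCompleteLocalRing.isAdicComplete
  obtain ⟨p, hp⟩ := CharP.exists (R ⧸ maximalIdeal R)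
  have hpm : (p : R) ∈ maximalIdeal R := by
    rw [← Ideal.Quotient.eq_zero_iff_mem, map_natCast, CharP.cast_eq_zero]
  obtain ⟨V, hV⟩ := CoefficientRing.exists_isCoeffRing (m := maximalIdeal R) (p := p)
  have hloc := hV.isLocalRing hpm
  have hmax := hV.maximalIdeal_eq hpm
  have hcomp := hV.isAdicComplete hpm
  have hnoeth : IsNoetherianRing V := (isNoetherianRing_iff_ideal_fg V).2 fun I => by
    rcases Ideal.eq_bot_or_eq_span_pow hmax I with rfl | ⟨j, rfl⟩
    · exact Submodule.fg_bot
    · exact Submodule.fg_span_singleton _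
  have : IsCompleteLocalRing V := { isAdicComplete := by rwa [hmax] }
  exact exists_finite_isGorensteinLocal_of_ringHom V.subtype hmax hpm fun r => by
    obtain ⟨v, hv, h⟩ := hV.exists_sub_mem r
    exact ⟨⟨v, hv⟩, h⟩

end LocalDuality

end

theorem proposition2p2 (R : Type u) [CommRing R] [LocalDuality.IsCompleteLocalRing R] :
    (∀ (S : Type u) [CommRing S] [LocalDuality.IsCompleteLocalRing S] (φ : S →+* R),
      φ.Finite → ∀ Ω : ModuleCat.{u} R,
        Nonempty ((ModuleCat.restrictScalars φ).obj (LocalDuality.matlisDual Ω) ≅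
          LocalDuality.matlisDual ((ModuleCat.restrictScalars φ).obj Ω)) ∧
        (∀ i : ℕ, Nonempty ((ModuleCat.restrictScalars φ).obj (LocalDuality.H Ω i) ≅
          LocalDuality.H ((ModuleCat.restrictScalars φ).obj Ω) i)) ∧
        (∀ r : ℤ, r = (LocalDuality.dim S : ℤ) - (LocalDuality.dim R : ℤ) →
          ∀ i : ℤ, Nonempty ((ModuleCat.restrictScalars φ).obj (LocalDuality.pcan Ω i) ≅
            LocalDuality.pcan ((ModuleCat.restrictScalars φ).obj Ω) (r + i)))) ∧
    (∃ (S : Type u) (_ : CommRing S) (_ : LocalDuality.IsCompleteLocalRing S) (φ : S →+* R),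
      LocalDuality.IsGorensteinLocal S ∧ LocalDuality.IsCohenMacaulayLocal S ∧
      φ.Finite ∧ LocalDuality.dim S = LocalDuality.dim R ∧
      ∀ (Ω : ModuleCat.{u} R) (i : ℤ),
        Nonempty ((ModuleCat.restrictScalars φ).obj (LocalDuality.pcan Ω i) ≅
          LocalDuality.pcan ((ModuleCat.restrictScalars φ).obj Ω) i)) := by
  refine ⟨fun S _ _ φ hφ Ω => ⟨LocalDuality.nonempty_restrictScalars_matlisDual_iso hφ Ω,
    LocalDuality.nonempty_restrictScalars_H_iso hφ Ω, fun r hr i =>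
      LocalDuality.nonempty_restrictScalars_pcan_iso hφ Ω r i hr⟩, ?_⟩
  obtain ⟨S, _, hS, φ, hG, hCM, hφ, hdim⟩ := LocalDuality.exists_finite_gorenstein R
  have hdim' : LocalDuality.dim S = LocalDuality.dim R := by
    rw [LocalDuality.dim, LocalDuality.dim, hdim]
  refine ⟨S, inferInstance, hS, φ, hG, hCM, hφ, hdim', fun Ω i => ?_⟩
  have := LocalDuality.nonempty_restrictScalars_pcan_iso hφ Ω 0 i (by rw [hdim', sub_self])
  rwa [zero_add] at this
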